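/- Let $n\in\mathbb N$ and $0\le\alpha<\frac{\pi}{2}$. Let $\Pi_n^{\alpha}$ be the set of complex $n\times n$ matrices $X$ such that every unit vector $x\in\mathbb C^n$ satisfies $\Re\langle Xx,x\rangle>0$ and $|\Im\langle Xx,x\rangle|\le(\tan\alpha)\,\Re\langle Xx,x\rangle$. For a complex matrix $X$ put $\Re X=\frac{X+X^*}{2}$. For a matrix $X$ whose spectrum does not meet $(-\infty,0]$ and $s\in\mathbb R$, let $X^s=\frac1{2\pi i}\int_{\Gamma} z^s(zI-X)^{-1}\,dz$, where $z^s$ is the principal branch and $\Gamma$ is a positively oriented simple closed curve in $\mathbb C\setminus(-\infty,0]$ surrounding the spectrum of $X$. For $0\le t\le1$ and $X,Y\in\Pi_n^{\alpha}$ let $$X\sharp_tY=X^{1/2}\left(X^{-1/2}\,Y\,X^{-1/2}\right)^{t}X^{1/2}.$$ Then for all $A,B,C,D\in\Pi_n^{\alpha}$ and all $0\le t,\lambda\le1$, $$\Re\bigl(\lambda(A\sharp_tC)+(1-\lambda)(B\sharp_tD)\bigr)\le\sec^2\alpha\,\Bigl(\Re\bigl(\lambda A+(1-\lambda)B\bigr)\,\sharp_t\,\Re\bigl(\lambda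 C+(1-\lambda)D\bigr)\Bigr),$$ where $P\le Q$ for Hermitian matrices means that $Q-P$ is positive semidefinite. -/

import Mathlib

open scoped MatrixOrder ComplexStarModule

noncomputable section

/-- The sectorial matrices of angle `α`: the numerical range lies in the sector
`{z | 0 < Re z, |Im z| ≤ tan α * Re z}`. Here `star x ⬝ᵥ A.mulVec x` is `⟨A x, x⟩`, and
`star x ⬝ᵥ x = 1` says that `x` is a unit vector of `ℂⁿ`. -/
def sectorialMatrices (n : ℕ) (α : ℝ) : Set (Matrix (Fin n) (Fin n) ℂ) :=
  {A | ∀ x : Fin n → ℂ, star x ⬝ᵥ x = 1 →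
    0 < (star x ⬝ᵥ A.mulVec x).re ∧
      |(star x ⬝ᵥ A.mulVec x).im| ≤ Real.tan α * (star x ⬝ᵥ A.mulVec x).re}

/-- The data of a simple closed curve in `ℂ \ (-∞, 0]`: the boundary of the
truncated sector `{z | r < |z| < R, |arg z| < θ}` with `0 < r < R` and `0 < θ < π`. -/
structure KeyholeContour where
  r : ℝ
  R : ℝ
  θ : ℝ
  r_pos : 0 < r
  r_lt_R : r < R
  θ_pos : 0 < θ
  θ_lt_pi : θ < Real.pi

namespace KeyholeContour

/-- The region surrounded by the curve. -/
def inside (γ : KeyholeContour) : Set ℂ :=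
  {z | γ.r < ‖z‖ ∧ ‖z‖ < γ.R ∧ |z.arg| < γ.θ}

/-- The contour integral `∫_γ g(z) dz`, counterclockwise: the outer arc, the segment at angle `θ`
towards the origin, the inner arc backwards, and the segment at angle `-θ` away from the origin. -/
def integral (γ : KeyholeContour) (g : ℂ → ℂ) : ℂ :=
  (∫ φ in (-γ.θ)..γ.θ, g (γ.R * Complex.exp (φ * Complex.I)) *
      (γ.R * Complex.exp (φ * Complex.I) * Complex.I))
  - (∫ ρ in γ.r..γ.R, g (ρ * Complex.exp (γ.θ * Complex.I)) * Complex.exp (γ.θ * Complex.I))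
  - (∫ φ in (-γ.θ)..γ.θ, g (γ.r * Complex.exp (φ * Complex.I)) *
      (γ.r * Complex.exp (φ * Complex.I) * Complex.I))
  + (∫ ρ in γ.r..γ.R, g (ρ * Complex.exp (-γ.θ * Complex.I)) * Complex.exp (-γ.θ * Complex.I))

end KeyholeContour

/-- The Cauchy integral `(2πi)⁻¹ ∫_γ f(z) (z I - A)⁻¹ dz`, taken entry by entry. -/
def cauchyMatrix {n : ℕ} (f : ℂ → ℂ) (A : Matrix (Fin n) (Fin n) ℂ) (γ : KeyholeContour) :
    Matrix (Fin n) (Fin n) ℂ :=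
  Matrix.of fun i j =>
    (2 * Real.pi * Complex.I)⁻¹ *
      γ.integral fun z => f z * (z • (1 : Matrix (Fin n) (Fin n) ℂ) - A)⁻¹ i j

open Classical in
/-- The matrix `f(A)` for `f` analytic on `ℂ \ (-∞, 0]` and `A` with spectrum in that domain: the
Cauchy integral along some curve in the domain that surrounds the spectrum. Such a curve exists
because the spectrum is finite, and by Cauchy's theorem the value does not depend on its choice.
The value is `0` if the spectrum meets `(-∞, 0]`. -/
def matrixFun {n : ℕ} (f : ℂ → ℂ) (A : Matrix (Fin n) (Fin n) ℂ) : Matrix (Fin n) (Fin n) ℂ :=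
  if h : ∃ γ : KeyholeContour, spectrum ℂ A ⊆ γ.inside then cauchyMatrix f A h.choose else 0

/-- The principal power `A ^ s`, for `A` with spectrum in `ℂ \ (-∞, 0]`. -/
def matrixPow {n : ℕ} (A : Matrix (Fin n) (Fin n) ℂ) (s : ℝ) : Matrix (Fin n) (Fin n) ℂ :=
  matrixFun (fun z => z ^ (s : ℂ)) A

/-- The weighted geometric mean `A ♯_t B = A^(1/2) (A^(-1/2) B A^(-1/2))^t A^(1/2)`. -/
def weightedGeomMean {n : ℕ} (t : ℝ) (A B : Matrix (Fin n) (Fin n) ℂ) :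
    Matrix (Fin n) (Fin n) ℂ :=
  matrixPow A (1 / 2) *
    matrixPow (matrixPow A (-(1 / 2)) * B * matrixPow A (-(1 / 2))) t *
      matrixPow A (1 / 2)

end

/-! For `0 < t < 1` the mean is an average of parallel sums: `X ♯_t Y = c_t ∫₀^∞ s^(t-1) Z(s) ds`
with `Z(s) = (X⁻¹ + s Y⁻¹)⁻¹` and `c_t > 0`. So it suffices to compare the parallel sums for each
fixed `s`.

Split `x = u + v` with `X u = Z x` and `Y v = s Z x`. For every other splitting `x = y + z`, `⟨Z x,
x⟩ = ⟨X u, y⟩ + s⁻¹ ⟨Y v, z⟩` (`quadForm_eq_of_parallelSum`). The sectorial Cauchy–Schwarz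
inequality `2 Re⟨X u, y⟩ ≤ Re⟨X u, u⟩ + sec²α Re⟨X y, y⟩` (`re_star_dotProduct_le`), and its
analogue for `Y`, bound the real part of the right side by `½ Re⟨Z x, x⟩ + ½ sec²α (Re⟨X y, y⟩ + s⁻¹
Re⟨Y z, z⟩)`. Absorbing the first term gives `re_quadForm_parallelSum_le`. The bound depends on `X`
and `Y` only through their real parts and is additive in them. Taking for `(y, z)` the splitting
that belongs to the real parts of the two convex combinations turns the combined bound into `sec²α`
times the quadratic form of their parallel sum. Integration over `s` finishes the proof; at `t = 0`
and `t = 1` the mean is one of its arguments and `sec²α ≥ 1` is enough.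

The integral formula comes from the scalar one, `z^t = c_t ∫₀^∞ s^(t-1) z/(s+z) ds` on the slit
plane (`cpow_eq_integral`), inserted into the Cauchy integral and transformed by Fubini
(`matrixPow_apply_eq_integral`). This requires that the Cauchy integral defines a multiplicative
functional calculus (`matrixFun_mul`), independently of the contour that was chosen. -/

/-! ### Contour integrals over keyholes, via the exponential map -/

/-- The integral of `f` over the boundary of the rectangle `[a, b] × [c, d]`, counterclockwise. -/
noncomputable def boundaryRectIntegral (f : ℂ → ℂ) (a b c d : ℝ) : ℂ :=
  (∫ x : ℝ in a..b, f (x + c * Complex.I)) - (∫ x : ℝ in a..b, f (x + d * Complex.I)) +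
    Complex.I * (∫ y : ℝ in c..d, f (b + y * Complex.I)) -
    Complex.I * (∫ y : ℝ in c..d, f (a + y * Complex.I))

theorem boundaryRectIntegral_eq_zero {f : ℂ → ℂ} {a b c d : ℝ} (hab : a ≤ b) (hcd : c ≤ d)
    (hf : ∀ w : ℂ, a ≤ w.re → w.re ≤ b → c ≤ w.im → w.im ≤ d → DifferentiableAt ℂ f w) :
    boundaryRectIntegral f a b c d = 0 := by
  have h := Complex.integral_boundary_rect_eq_zero_of_differentiableOn f ⟨a, c⟩ ⟨b, d⟩ (by
    intro w hw
    simp only [Set.uIcc_of_le hab, Set.uIcc_of_le hcd] at hw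
    exact (hf w hw.1.1 hw.1.2 hw.2.1 hw.2.2).differentiableWithinAt)
  simpa [boundaryRectIntegral] using h

theorem boundaryRectIntegral_add {f : ℂ → ℂ} {a b c d e : ℝ}
    (hb : Continuous fun y : ℝ => f (b + y * Complex.I))
    (ha : Continuous fun y : ℝ => f (a + y * Complex.I)) :
    boundaryRectIntegral f a b c d + boundaryRectIntegral f a b d e =
      boundaryRectIntegral f a b c e := by
  unfold boundaryRectIntegral
  rw [← intervalIntegral.integral_add_adjacent_intervals (hb.intervalIntegrable c d)
    (hb.intervalIntegrable d e), ← intervalIntegral.integral_add_adjacent_intervals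
    (ha.intervalIntegrable c d) (ha.intervalIntegrable d e)]
  ring

/-- The pullback of the differential form `g(z) dz` under the exponential map. -/
noncomputable def expPullback (g : ℂ → ℂ) (w : ℂ) : ℂ := g (Complex.exp w) * Complex.exp w

theorem exp_log_add_mul_I {ρ : ℝ} (hρ : 0 < ρ) (φ : ℂ) :
    Complex.exp ((Real.log ρ : ℝ) + φ * Complex.I) = ρ * Complex.exp (φ * Complex.I) := by
  rw [Complex.exp_add, ← Complex.ofReal_exp, Real.exp_log hρ]

namespace KeyholeContour

theorem R_pos (γ : KeyholeContour) : 0 < γ.R := γ.r_pos.trans γ.r_lt_R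

theorem integral_ray (γ : KeyholeContour) (g : ℂ → ℂ) (φ : ℂ) :
    ∫ ρ in γ.r..γ.R, g (ρ * Complex.exp (φ * Complex.I)) * Complex.exp (φ * Complex.I) =
      ∫ x : ℝ in Real.log γ.r..Real.log γ.R, expPullback g (x + φ * Complex.I) := by
  have h := intervalIntegral.integral_deriv_smul_comp_of_deriv_nonneg
    (a := Real.log γ.r) (b := Real.log γ.R) (f := Real.exp) (f' := Real.exp)
    (g := fun ρ : ℝ => g (ρ * Complex.exp (φ * Complex.I)) * Complex.exp (φ * Complex.I))
    Real.continuous_exp.continuousOn (fun x _ => Real.hasDerivAt_exp x)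
    (fun x _ => (Real.exp_pos x).le)
  rw [Real.exp_log γ.r_pos, Real.exp_log γ.R_pos] at h
  rw [← h]
  refine intervalIntegral.integral_congr fun x _ => ?_
  simp only [expPullback, Function.comp, Complex.exp_add, Complex.real_smul, Complex.ofReal_exp]
  ring

theorem integral_arc (g : ℂ → ℂ) {ρ : ℝ} (hρ : 0 < ρ) (c d : ℝ) :
    ∫ φ in c..d, g (ρ * Complex.exp (φ * Complex.I)) *
      (ρ * Complex.exp (φ * Complex.I) * Complex.I) =
      Complex.I * ∫ φ : ℝ in c..d, expPullback g ((Real.log ρ : ℝ) + φ * Complex.I) := by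
  rw [← intervalIntegral.integral_const_mul]
  refine intervalIntegral.integral_congr fun x _ => ?_
  simp only [expPullback, exp_log_add_mul_I hρ]
  ring

/-- In logarithmic coordinates `z = exp w` the keyhole is a rectangle, so Cauchy's theorem for
rectangles is all that is needed. -/
theorem integral_eq_boundaryRectIntegral (γ : KeyholeContour) (g : ℂ → ℂ) :
    γ.integral g =
      boundaryRectIntegral (expPullback g) (Real.log γ.r) (Real.log γ.R) (-γ.θ) γ.θ := by
  rw [KeyholeContour.integral, integral_ray γ g γ.θ, integral_ray γ g (-γ.θ),
    integral_arc g γ.R_pos, integral_arc g γ.r_pos, boundaryRectIntegral]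
  push_cast
  ring

theorem exp_mem_slitPlane_of_im_mem_Ioo {w : ℂ} (h₁ : -Real.pi < w.im) (h₂ : w.im < Real.pi) :
    Complex.exp w ∈ Complex.slitPlane := by
  rw [Complex.mem_slitPlane_iff_arg, Complex.arg_exp,
    (toIocMod_eq_self Real.two_pi_pos).2 ⟨h₁, by linarith⟩]
  exact ⟨h₂.ne, Complex.exp_ne_zero _⟩

theorem integral_eq_zero (γ : KeyholeContour) {g : ℂ → ℂ}
    (hg : DifferentiableOn ℂ g Complex.slitPlane) : γ.integral g = 0 := by
  rw [integral_eq_boundaryRectIntegral]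
  have h1 := γ.θ_pos
  have h2 := γ.θ_lt_pi
  refine boundaryRectIntegral_eq_zero (Real.log_le_log γ.r_pos γ.r_lt_R.le) (by linarith) ?_
  intro w _ _ hc hd
  have hw : Complex.exp w ∈ Complex.slitPlane :=
    exp_mem_slitPlane_of_im_mem_Ioo (by linarith) (by linarith)
  have := (hg.differentiableAt (Complex.isOpen_slitPlane.mem_nhds hw)).comp w
    Complex.differentiable_exp.differentiableAt
  exact this.mul Complex.differentiable_exp.differentiableAt

/-- If `g` is holomorphic in the part of the annulus outside of the contour, then the integral along
the contour is the difference of the integrals along the two circles. -/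
theorem integral_eq_sub_circle (γ : KeyholeContour) {g : ℂ → ℂ}
    (hg : ∀ z : ℂ, γ.r ≤ ‖z‖ → ‖z‖ ≤ γ.R → z ∉ γ.inside → DifferentiableAt ℂ g z) :
    γ.integral g =
      Complex.I * (∫ y : ℝ in (-Real.pi)..Real.pi,
        g (γ.R * Complex.exp (y * Complex.I)) * (γ.R * Complex.exp (y * Complex.I))) -
      Complex.I * (∫ y : ℝ in (-Real.pi)..Real.pi,
        g (γ.r * Complex.exp (y * Complex.I)) * (γ.r * Complex.exp (y * Complex.I))) := by
  have h1 := γ.θ_pos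
  have h2 := γ.θ_lt_pi
  have hlog : Real.log γ.r ≤ Real.log γ.R := Real.log_le_log γ.r_pos γ.r_lt_R.le
  have hdiff : ∀ w : ℂ, Real.log γ.r ≤ w.re → w.re ≤ Real.log γ.R → Complex.exp w ∉ γ.inside →
      DifferentiableAt ℂ (expPullback g) w := by
    intro w ha hb hw
    have hn : ‖Complex.exp w‖ = Real.exp w.re := Complex.norm_exp w
    have := (hg (Complex.exp w) (by rw [hn]; exact (Real.log_le_iff_le_exp γ.r_pos).1 ha)
      (by rw [hn]; exact (Real.le_log_iff_exp_le γ.R_pos).1 hb) hw).comp w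
      Complex.differentiable_exp.differentiableAt
    exact this.mul Complex.differentiable_exp.differentiableAt
  have hcont : ∀ x : ℝ, x = Real.log γ.r ∨ x = Real.log γ.R →
      Continuous fun y : ℝ => expPullback g (x + y * Complex.I) := by
    intro x hx
    refine continuous_iff_continuousAt.2 fun y => ?_
    have hd : DifferentiableAt ℂ (expPullback g) (x + y * Complex.I) := by
      have hre : ((x : ℂ) + y * Complex.I).re = x := by simp
      refine hdiff _ ?_ ?_ ?_
      · rw [hre]; rcases hx with rfl | rfl <;> simp [hlog]
      · rw [hre]; rcases hx with rfl | rfl <;> simp [hlog]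
      · rintro ⟨h3, h4, -⟩
        rw [Complex.norm_exp, hre] at h3 h4
        rcases hx with rfl | rfl
        · rw [Real.exp_log γ.r_pos] at h3; exact lt_irrefl _ h3
        · rw [Real.exp_log γ.R_pos] at h4; exact lt_irrefl _ h4
    exact hd.continuousAt.comp (f := fun y : ℝ => (x : ℂ) + y * Complex.I)
      (by fun_prop)
  -- The rectangle is enlarged to height `[-π, π]` by two rectangles on which the pullback is
  -- holomorphic. The new horizontal sides then cancel because `exp` has period `2πi`, and the
  -- vertical sides become full circles.
  have htop : boundaryRectIntegral (expPullback g) (Real.log γ.r) (Real.log γ.R) γ.θ Real.pi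
      = 0 := by
    refine boundaryRectIntegral_eq_zero hlog h2.le fun w ha hb hc hd => hdiff w ha hb ?_
    rintro ⟨-, -, h3⟩
    rw [Complex.arg_exp, (toIocMod_eq_self Real.two_pi_pos).2 ⟨by linarith, by linarith⟩] at h3
    linarith [le_abs_self w.im]
  have hbot : boundaryRectIntegral (expPullback g) (Real.log γ.r) (Real.log γ.R) (-Real.pi) (-γ.θ)
      = 0 := by
    refine boundaryRectIntegral_eq_zero hlog (by linarith) fun w ha hb hc hd => hdiff w ha hb ?_
    rintro ⟨-, -, h3⟩
    -- On the edge `Im w = -π` the principal argument of `exp w` is `π`, not `-π`.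
    rcases hc.eq_or_lt with h | h
    · have : (Complex.exp w).arg = Real.pi := by
        rw [Complex.arg_exp, ← h, toIocMod_apply_left]; ring
      rw [this, abs_of_pos Real.pi_pos] at h3
      linarith
    · rw [Complex.arg_exp, (toIocMod_eq_self Real.two_pi_pos).2 ⟨h, by linarith⟩] at h3
      linarith [neg_abs_le w.im]
  have key := boundaryRectIntegral_add (f := expPullback g) (a := Real.log γ.r)
    (b := Real.log γ.R) (c := -γ.θ) (d := γ.θ) (e := Real.pi)
    (hcont _ (Or.inr rfl)) (hcont _ (Or.inl rfl))
  have key' := boundaryRectIntegral_add (f := expPullback g) (a := Real.log γ.r)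
    (b := Real.log γ.R) (c := -Real.pi) (d := -γ.θ) (e := Real.pi)
    (hcont _ (Or.inr rfl)) (hcont _ (Or.inl rfl))
  rw [htop, add_zero] at key
  rw [hbot, zero_add] at key'
  rw [integral_eq_boundaryRectIntegral, key, key', boundaryRectIntegral]
  have hper : ∀ x : ℝ, expPullback g (x + (-Real.pi : ℝ) * Complex.I) =
      expPullback g (x + (Real.pi : ℝ) * Complex.I) := by
    intro x
    have : Complex.exp (x + (-Real.pi : ℝ) * Complex.I) =
        Complex.exp (x + (Real.pi : ℝ) * Complex.I) := by
      rw [Complex.exp_eq_exp_iff_exists_int]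
      exact ⟨-1, by push_cast; ring⟩
    simp only [expPullback, this]
  simp only [hper, sub_self, zero_add]
  simp only [expPullback, exp_log_add_mul_I γ.R_pos, exp_log_add_mul_I γ.r_pos]

end KeyholeContour

/-- The mean value property on a circle centred at the origin. -/
theorem integral_circle_eq_of_differentiableOn {f : ℂ → ℂ} {ρ : ℝ} (hρ : 0 < ρ)
    (hf : ∀ z : ℂ, ‖z‖ ≤ ρ → DifferentiableAt ℂ f z) :
    ∫ y : ℝ in (-Real.pi)..Real.pi, f (ρ * Complex.exp (y * Complex.I)) =
      2 * Real.pi * f 0 := by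
  have h : Real.circleAverage f 0 ρ = f 0 :=
    circleAverage_of_differentiable_on_off_countable (s := ∅) Set.countable_empty
      (fun z hz => (hf z (by simpa [abs_of_pos hρ] using hz)).continuousAt.continuousWithinAt)
      (fun z hz => hf z (by simpa [abs_of_pos hρ] using (Metric.mem_ball.1 hz.1).le))
  have hp : Function.Periodic (fun y : ℝ => f (ρ * Complex.exp (y * Complex.I)))
      (2 * Real.pi) := by
    intro y
    have : Complex.exp ((y + 2 * Real.pi : ℝ) * Complex.I) = Complex.exp (y * Complex.I) := by
      rw [Complex.exp_eq_exp_iff_exists_int]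
      exact ⟨1, by push_cast; ring⟩
    simp only [this]
  have h2 := hp.intervalIntegral_add_eq (-Real.pi) 0
  rw [show -Real.pi + 2 * Real.pi = Real.pi by ring, zero_add] at h2
  rw [h2, ← h, Real.circleAverage_def]
  simp only [circleMap, zero_add, Complex.real_smul]
  push_cast
  rw [mul_inv_cancel_left₀ (by simp [Real.pi_ne_zero])]

/-- The integral of `g(z) dz` along the curve `c` with derivative `c'`. -/
noncomputable def parametrizedIntegral (c c' : ℝ → ℂ) (a b : ℝ) (g : ℂ → ℂ) : ℂ :=
  ∫ u in a..b, g (c u) * c' u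

namespace KeyholeContour

/-- A set that contains the curve: the closure of the truncated sector without its interior. -/
def carrier (γ : KeyholeContour) : Set ℂ :=
  {z | γ.r ≤ ‖z‖ ∧ ‖z‖ ≤ γ.R ∧ |z.arg| ≤ γ.θ ∧ z ∉ γ.inside}

theorem carrier_subset_slitPlane (γ : KeyholeContour) : γ.carrier ⊆ Complex.slitPlane := by
  rintro z ⟨h1, -, h3, -⟩
  rw [Complex.mem_slitPlane_iff_arg]
  refine ⟨fun h => ?_, fun h => ?_⟩
  · rw [h, abs_of_pos Real.pi_pos] at h3
    linarith [γ.θ_lt_pi]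
  · rw [h, norm_zero] at h1
    linarith [γ.r_pos]

theorem norm_mul_exp {ρ : ℝ} (hρ : 0 < ρ) (φ : ℝ) :
    ‖(ρ : ℂ) * Complex.exp (φ * Complex.I)‖ = ρ := by
  simp [Complex.norm_exp_ofReal_mul_I, abs_of_pos hρ]

theorem arg_mul_exp {ρ φ : ℝ} (hρ : 0 < ρ) (h₁ : -Real.pi < φ) (h₂ : φ ≤ Real.pi) :
    ((ρ : ℂ) * Complex.exp (φ * Complex.I)).arg = φ := by
  rw [Complex.arg_real_mul _ hρ, Complex.arg_exp_mul_I,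
    (toIocMod_eq_self Real.two_pi_pos).2 ⟨h₁, by linarith⟩]

theorem mul_exp_mem_carrier (γ : KeyholeContour) {ρ φ : ℝ} (h₁ : γ.r ≤ ρ) (h₂ : ρ ≤ γ.R)
    (h₃ : |φ| ≤ γ.θ) (h : ρ = γ.r ∨ ρ = γ.R ∨ |φ| = γ.θ) :
    (ρ : ℂ) * Complex.exp (φ * Complex.I) ∈ γ.carrier := by
  have hρ : 0 < ρ := γ.r_pos.trans_le h₁
  have hφ := abs_le.1 h₃
  have hn := norm_mul_exp hρ φ
  have ha := arg_mul_exp hρ (φ := φ) (by linarith [γ.θ_lt_pi]) (by linarith [γ.θ_lt_pi])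
  refine ⟨by rwa [hn], by rwa [hn], by rwa [ha], ?_⟩
  rintro ⟨h4, h5, h6⟩
  rw [hn] at h4 h5
  rw [ha] at h6
  rcases h with h | h | h <;> linarith

/-- The contour integral is a signed sum of integrals along four smooth curves in `γ.carrier`. -/
theorem exists_curves (γ : KeyholeContour) : ∃ c c' : Fin 4 → ℝ → ℂ, ∃ a b : Fin 4 → ℝ,
    ∃ ε : Fin 4 → ℂ, (∀ k, Continuous (c k)) ∧ (∀ k, Continuous (c' k)) ∧
      (∀ k, ∀ u ∈ Set.uIcc (a k) (b k), c k u ∈ γ.carrier) ∧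
      ∀ g, γ.integral g = ∑ k, ε k * parametrizedIntegral (c k) (c' k) (a k) (b k) g := by
  have h1 := γ.θ_pos
  have h2 := γ.r_lt_R
  refine ⟨![fun φ => γ.R * Complex.exp (φ * Complex.I), fun ρ => ρ * Complex.exp (γ.θ * Complex.I),
    fun φ => γ.r * Complex.exp (φ * Complex.I), fun ρ => ρ * Complex.exp (-γ.θ * Complex.I)],
    ![fun φ => γ.R * Complex.exp (φ * Complex.I) * Complex.I,
      fun _ => Complex.exp (γ.θ * Complex.I),
      fun φ => γ.r * Complex.exp (φ * Complex.I) * Complex.I,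
      fun _ => Complex.exp (-γ.θ * Complex.I)],
    ![-γ.θ, γ.r, -γ.θ, γ.r], ![γ.θ, γ.R, γ.θ, γ.R], ![1, -1, -1, 1], ?_, ?_, ?_, ?_⟩
  · intro k
    fin_cases k <;> simp <;> fun_prop
  · intro k
    fin_cases k <;> simp <;> fun_prop
  · intro k u hu
    fin_cases k <;> simp only [Fin.zero_eta, Fin.mk_one, Fin.reduceFinMk, Matrix.cons_val] at hu ⊢
    · rw [Set.uIcc_of_le (by linarith)] at hu
      exact γ.mul_exp_mem_carrier h2.le le_rfl (abs_le.2 hu) (by simp)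
    · rw [Set.uIcc_of_le (by linarith)] at hu
      exact γ.mul_exp_mem_carrier hu.1 hu.2 (by rw [abs_of_pos h1]) (by simp [abs_of_pos h1])
    · rw [Set.uIcc_of_le (by linarith)] at hu
      exact γ.mul_exp_mem_carrier le_rfl h2.le (abs_le.2 hu) (by simp)
    · rw [Set.uIcc_of_le (by linarith)] at hu
      have := γ.mul_exp_mem_carrier (φ := -γ.θ) hu.1 hu.2 (by rw [abs_neg, abs_of_pos h1])
        (by simp [abs_of_pos h1])
      simpa using this
  · intro g
    simp only [Fin.sum_univ_four, parametrizedIntegral, Matrix.cons_val, KeyholeContour.integral]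
    ring

theorem integral_congr (γ : KeyholeContour) {g h : ℂ → ℂ} (hgh : Set.EqOn g h γ.carrier) :
    γ.integral g = γ.integral h := by
  obtain ⟨c, c', a, b, ε, -, -, hm, hi⟩ := γ.exists_curves
  rw [hi, hi]
  refine Finset.sum_congr rfl fun k _ => congrArg _ ?_
  exact intervalIntegral.integral_congr fun u hu => by simp only [hgh (hm k u hu)]

theorem integral_const_mul (γ : KeyholeContour) (x : ℂ) (g : ℂ → ℂ) :
    γ.integral (fun z => x * g z) = x * γ.integral g := by
  obtain ⟨c, c', a, b, ε, -, -, hm, hi⟩ := γ.exists_curves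
  rw [hi, hi, Finset.mul_sum]
  refine Finset.sum_congr rfl fun k _ => ?_
  simp only [parametrizedIntegral, mul_assoc, intervalIntegral.integral_const_mul]
  ring

theorem integral_finset_sum (γ : KeyholeContour) {ι : Type*} (s : Finset ι) {g : ι → ℂ → ℂ}
    (hg : ∀ i ∈ s, ContinuousOn (g i) γ.carrier) :
    γ.integral (fun z => ∑ i ∈ s, g i z) = ∑ i ∈ s, γ.integral (g i) := by
  obtain ⟨c, c', a, b, ε, hc, hc', hm, hi⟩ := γ.exists_curves
  simp only [hi]
  rw [Finset.sum_comm]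
  refine Finset.sum_congr rfl fun k _ => ?_
  rw [← Finset.mul_sum]
  congr 1
  simp only [parametrizedIntegral, Finset.sum_mul]
  refine intervalIntegral.integral_finsetSum fun i hi => ContinuousOn.intervalIntegrable ?_
  exact ((hg i hi).comp (hc k).continuousOn fun u hu => hm k u hu).mul (hc' k).continuousOn

theorem integral_add (γ : KeyholeContour) {g h : ℂ → ℂ} (hg : ContinuousOn g γ.carrier)
    (hh : ContinuousOn h γ.carrier) :
    γ.integral (fun z => g z + h z) = γ.integral g + γ.integral h := by
  have := γ.integral_finset_sum (g := ![g, h]) Finset.univ (by intro i; fin_cases i <;> simpa)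
  simpa using this

end KeyholeContour

/-! ### The resolvent and its contour integral -/

section Resolvent

variable {n : ℕ} (A : Matrix (Fin n) (Fin n) ℂ)

theorem eval_charpoly_eq_det (z : ℂ) : A.charpoly.eval z = (z • (1 : Matrix (Fin n) (Fin n) ℂ) - A).det := by
  rw [Matrix.eval_charpoly, Matrix.scalar_apply, Matrix.smul_one_eq_diagonal]

theorem det_ne_zero_of_notMem_spectrum {z : ℂ} (hz : z ∉ spectrum ℂ A) :
    (z • (1 : Matrix (Fin n) (Fin n) ℂ) - A).det ≠ 0 := by
  rw [Matrix.mem_spectrum_iff_isRoot_charpoly, Polynomial.IsRoot.def, eval_charpoly_eq_det] at hz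
  exact hz

theorem differentiable_det {N : ℂ → Matrix (Fin n) (Fin n) ℂ}
    (hN : ∀ i j, Differentiable ℂ fun z => N z i j) : Differentiable ℂ fun z => (N z).det := by
  simp only [Matrix.det_apply]
  fun_prop

theorem differentiable_adjugate {N : ℂ → Matrix (Fin n) (Fin n) ℂ}
    (hN : ∀ i j, Differentiable ℂ fun z => N z i j) (i j : Fin n) :
    Differentiable ℂ fun z => (N z).adjugate i j := by
  simp only [Matrix.adjugate_apply]
  refine differentiable_det fun k l => ?_
  simp only [Matrix.updateRow_apply]
  split_ifs
  · exact differentiable_const _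
  · exact hN k l

theorem inv_apply_eq (N : Matrix (Fin n) (Fin n) ℂ) (i j : Fin n) :
    N⁻¹ i j = (N.det)⁻¹ * N.adjugate i j := by
  rw [Matrix.inv_def, Ring.inverse_eq_inv', Matrix.smul_apply, smul_eq_mul]

theorem differentiableAt_inv_apply {N : ℂ → Matrix (Fin n) (Fin n) ℂ}
    (hN : ∀ i j, Differentiable ℂ fun z => N z i j) {z : ℂ} (hz : (N z).det ≠ 0) (i j : Fin n) :
    DifferentiableAt ℂ (fun z => (N z)⁻¹ i j) z := by
  simp only [inv_apply_eq]
  exact ((differentiable_det hN z).inv hz).mul (differentiable_adjugate hN i j z)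

theorem differentiable_smul_one_sub (i j : Fin n) :
    Differentiable ℂ fun z : ℂ => (z • (1 : Matrix (Fin n) (Fin n) ℂ) - A) i j := by
  simp only [Matrix.sub_apply, Matrix.smul_apply, smul_eq_mul]
  fun_prop

theorem differentiableAt_resolvent_apply {z : ℂ} (hz : z ∉ spectrum ℂ A) (i j : Fin n) :
    DifferentiableAt ℂ (fun z : ℂ => (z • (1 : Matrix (Fin n) (Fin n) ℂ) - A)⁻¹ i j) z :=
  differentiableAt_inv_apply (differentiable_smul_one_sub A)
    (det_ne_zero_of_notMem_spectrum A hz) i j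

variable {A}

theorem continuousOn_resolvent_apply {γ : KeyholeContour} (h : spectrum ℂ A ⊆ γ.inside)
    (i j : Fin n) :
    ContinuousOn (fun z : ℂ => (z • (1 : Matrix (Fin n) (Fin n) ℂ) - A)⁻¹ i j) γ.carrier := fun _ hz =>
  (differentiableAt_resolvent_apply A (fun hs => hz.2.2.2 (h hs)) i j).continuousAt
    |>.continuousWithinAt

/-- The contour is the outer circle minus the inner one. Inside, `z (zI - A)⁻¹` is holomorphic and
vanishes at `0`. Outside, the substitution `w = z⁻¹` turns `z (zI - A)⁻¹` into `(I - wA)⁻¹`, which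
is holomorphic for `|w| ≤ R⁻¹` with value `I` at `0`. The mean value property gives both integrals.
-/
theorem integral_resolvent {γ : KeyholeContour} (h : spectrum ℂ A ⊆ γ.inside) (i j : Fin n) :
    γ.integral (fun z => (z • (1 : Matrix (Fin n) (Fin n) ℂ) - A)⁻¹ i j) =
      2 * Real.pi * Complex.I * (1 : Matrix (Fin n) (Fin n) ℂ) i j := by
  rw [γ.integral_eq_sub_circle fun z _ _ hz =>
    differentiableAt_resolvent_apply A (fun hs => hz (h hs)) i j]
  have hin := integral_circle_eq_of_differentiableOn (ρ := γ.r) γ.r_pos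
    (f := fun z => (z • (1 : Matrix (Fin n) (Fin n) ℂ) - A)⁻¹ i j * z) fun z hz =>
      (differentiableAt_resolvent_apply A (fun hs => by linarith [(h hs).1]) i j).mul
        differentiableAt_id
  have hout := integral_circle_eq_of_differentiableOn (ρ := γ.R⁻¹) (inv_pos.2 γ.R_pos)
    (f := fun w => ((1 : Matrix (Fin n) (Fin n) ℂ) - w • A)⁻¹ i j) fun w hw =>
      differentiableAt_inv_apply (N := fun w => (1 : Matrix (Fin n) (Fin n) ℂ) - w • A) (fun k l => by
        simp only [Matrix.sub_apply, Matrix.smul_apply, smul_eq_mul]; fun_prop) (by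
        rcases eq_or_ne w 0 with rfl | h0
        · simp
        · have hw' : w⁻¹ ∉ spectrum ℂ A := fun hs => by
            have h3 := (h hs).2.1
            rw [norm_inv] at h3
            have := (le_inv_comm₀ (norm_pos_iff.2 h0) γ.R_pos).1 hw
            linarith
          have h4 : (1 : Matrix (Fin n) (Fin n) ℂ) - w • A = w • (w⁻¹ • (1 : Matrix (Fin n) (Fin n) ℂ) - A) := by
            rw [smul_sub, smul_smul, mul_inv_cancel₀ h0, one_smul]
          rw [h4, Matrix.det_smul]
          exact mul_ne_zero (pow_ne_zero _ h0) (det_ne_zero_of_notMem_spectrum A hw')) i j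
  have hcongr : ∀ y : ℝ,
      (((γ.R : ℂ) * Complex.exp (y * Complex.I)) • (1 : Matrix (Fin n) (Fin n) ℂ) - A)⁻¹ i j *
        (γ.R * Complex.exp (y * Complex.I)) =
      ((1 : Matrix (Fin n) (Fin n) ℂ) - ((γ.R⁻¹ : ℝ) * Complex.exp ((-y : ℝ) * Complex.I)) • A)⁻¹ i j := by
    intro y
    set z := (γ.R : ℂ) * Complex.exp (y * Complex.I) with hzdef
    have hz0 : z ≠ 0 := mul_ne_zero (by exact_mod_cast γ.R_pos.ne') (Complex.exp_ne_zero _)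
    have hz1 : ((γ.R⁻¹ : ℝ) : ℂ) * Complex.exp ((-y : ℝ) * Complex.I) = z⁻¹ := by
      rw [hzdef, mul_inv, ← Complex.exp_neg]
      push_cast
      ring_nf
    have hdet : (z • (1 : Matrix (Fin n) (Fin n) ℂ) - A).det ≠ 0 :=
      det_ne_zero_of_notMem_spectrum A fun hs => by
        have := (h hs).2.1
        rw [hzdef, KeyholeContour.norm_mul_exp γ.R_pos] at this
        exact lt_irrefl _ this
    have h5 : ((1 : Matrix (Fin n) (Fin n) ℂ) - z⁻¹ • A)⁻¹ = z • (z • (1 : Matrix (Fin n) (Fin n) ℂ) - A)⁻¹ := by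
      refine Matrix.inv_eq_right_inv ?_
      have : (1 : Matrix (Fin n) (Fin n) ℂ) - z⁻¹ • A = z⁻¹ • (z • (1 : Matrix (Fin n) (Fin n) ℂ) - A) := by
        rw [smul_sub, smul_smul, inv_mul_cancel₀ hz0, one_smul]
      rw [this, Matrix.smul_mul, Matrix.mul_smul, smul_smul, inv_mul_cancel₀ hz0, one_smul,
        Matrix.mul_nonsing_inv _ (isUnit_iff_ne_zero.2 hdet)]
    rw [hz1, h5, Matrix.smul_apply, smul_eq_mul, mul_comm]
  have hneg := intervalIntegral.integral_comp_neg (a := -Real.pi) (b := Real.pi)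
    (fun y : ℝ => ((1 : Matrix (Fin n) (Fin n) ℂ) - ((γ.R⁻¹ : ℝ) * Complex.exp (y * Complex.I)) • A)⁻¹ i j)
  rw [neg_neg] at hneg
  simp only [hcongr]
  rw [hneg, hout, hin]
  simp
  ring

end Resolvent

/-! ### The Cauchy integral of polynomials and of multiples of the characteristic polynomial -/

section CauchyMatrix

variable {n : ℕ} {A : Matrix (Fin n) (Fin n) ℂ} {γ : KeyholeContour}

theorem cauchyMatrix_congr {f g : ℂ → ℂ} (hfg : Set.EqOn f g Complex.slitPlane) :
    cauchyMatrix f A γ = cauchyMatrix g A γ := by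
  ext i j
  simp only [cauchyMatrix, Matrix.of_apply]
  congr 1
  exact γ.integral_congr fun z hz => by simp only [hfg (γ.carrier_subset_slitPlane hz)]

theorem cauchyMatrix_add (h : spectrum ℂ A ⊆ γ.inside) {f g : ℂ → ℂ}
    (hf : ContinuousOn f Complex.slitPlane) (hg : ContinuousOn g Complex.slitPlane) :
    cauchyMatrix (fun z => f z + g z) A γ = cauchyMatrix f A γ + cauchyMatrix g A γ := by
  ext i j
  simp only [cauchyMatrix, Matrix.of_apply, Matrix.add_apply, add_mul]
  rw [← mul_add]
  exact congrArg _ (γ.integral_add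
    ((hf.mono γ.carrier_subset_slitPlane).mul (continuousOn_resolvent_apply h i j))
    ((hg.mono γ.carrier_subset_slitPlane).mul (continuousOn_resolvent_apply h i j)))

theorem cauchyMatrix_const_mul (x : ℂ) (f : ℂ → ℂ) :
    cauchyMatrix (fun z => x * f z) A γ = x • cauchyMatrix f A γ := by
  ext i j
  simp only [cauchyMatrix, Matrix.of_apply, Matrix.smul_apply, smul_eq_mul, mul_assoc]
  rw [γ.integral_const_mul]
  ring

theorem two_pi_I_ne_zero : (2 * Real.pi * Complex.I : ℂ) ≠ 0 := by
  simp [Real.pi_ne_zero]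

theorem cauchyMatrix_one (h : spectrum ℂ A ⊆ γ.inside) : cauchyMatrix (fun _ => 1) A γ = 1 := by
  ext i j
  simp only [cauchyMatrix, Matrix.of_apply, one_mul]
  rw [integral_resolvent h, inv_mul_cancel_left₀ two_pi_I_ne_zero]

/-- On the contour `z (zI - A)⁻¹ = I + A (zI - A)⁻¹`, and the term with `I` contributes the integral
of the holomorphic `f`, which is zero. -/
theorem cauchyMatrix_id_mul (h : spectrum ℂ A ⊆ γ.inside) {f : ℂ → ℂ}
    (hf : DifferentiableOn ℂ f Complex.slitPlane) :
    cauchyMatrix (fun z => z * f z) A γ = A * cauchyMatrix f A γ := by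
  have hfc := hf.continuousOn.mono γ.carrier_subset_slitPlane
  ext i j
  have h1 : Set.EqOn (fun z => z * f z * (z • (1 : Matrix (Fin n) (Fin n) ℂ) - A)⁻¹ i j)
      (fun z => (1 : Matrix (Fin n) (Fin n) ℂ) i j * f z +
        ∑ k, A i k * (f z * (z • (1 : Matrix (Fin n) (Fin n) ℂ) - A)⁻¹ k j)) γ.carrier := by
    intro z hz
    have h2 := Matrix.mul_nonsing_inv _ (isUnit_iff_ne_zero.2
      (det_ne_zero_of_notMem_spectrum A (z := z) fun hs => hz.2.2.2 (h hs)))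
    rw [Matrix.sub_mul, Matrix.smul_mul, Matrix.one_mul, sub_eq_iff_eq_add] at h2
    have h3 := congrArg (fun N : Matrix (Fin n) (Fin n) ℂ => N i j) h2
    simp only [Matrix.smul_apply, Matrix.add_apply, Matrix.mul_apply, smul_eq_mul] at h3
    simp only
    rw [mul_comm z, mul_assoc, h3, mul_add, Finset.mul_sum, mul_comm]
    congr 1
    exact Finset.sum_congr rfl fun k _ => by ring
  simp only [cauchyMatrix, Matrix.of_apply, Matrix.mul_apply]
  have hk : ∀ k, ContinuousOn
      (fun z => A i k * (f z * (z • (1 : Matrix (Fin n) (Fin n) ℂ) - A)⁻¹ k j)) γ.carrier :=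
    fun k => continuousOn_const.mul (hfc.mul (continuousOn_resolvent_apply h k j))
  have h0 : ContinuousOn (fun z => (1 : Matrix (Fin n) (Fin n) ℂ) i j * f z) γ.carrier :=
    continuousOn_const.mul hfc
  rw [γ.integral_congr h1, γ.integral_add h0
    (continuousOn_finsetSum _ fun k _ => hk k), γ.integral_const_mul, γ.integral_eq_zero hf,
    γ.integral_finset_sum _ fun k _ => hk k, mul_zero, zero_add, Finset.mul_sum]
  refine Finset.sum_congr rfl fun k _ => ?_
  rw [γ.integral_const_mul]
  ring

theorem cauchyMatrix_pow (h : spectrum ℂ A ⊆ γ.inside) (k : ℕ) :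
    cauchyMatrix (fun z => z ^ k) A γ = A ^ k := by
  induction k with
  | zero => simpa using cauchyMatrix_one h
  | succ k ih =>
    simp only [pow_succ']
    rw [cauchyMatrix_id_mul h (by fun_prop), ih]

theorem cauchyMatrix_eval (h : spectrum ℂ A ⊆ γ.inside) (p : Polynomial ℂ) :
    cauchyMatrix (fun z => p.eval z) A γ = Polynomial.aeval A p := by
  induction p using Polynomial.induction_on' with
  | add p q hp hq =>
    simp only [Polynomial.eval_add, map_add]
    rw [cauchyMatrix_add h p.continuous.continuousOn q.continuous.continuousOn, hp, hq]
  | monomial k a =>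
    simp only [Polynomial.eval_monomial]
    rw [cauchyMatrix_const_mul, cauchyMatrix_pow h, Polynomial.aeval_monomial,
      Algebra.smul_def]

/-- By Cramer's rule the characteristic polynomial times the resolvent is the adjugate of `zI - A`,
whose entries are entire, so the integrand has no singularity left inside the contour. -/
theorem cauchyMatrix_charpoly_mul (h : spectrum ℂ A ⊆ γ.inside) {g : ℂ → ℂ}
    (hg : DifferentiableOn ℂ g Complex.slitPlane) :
    cauchyMatrix (fun z => A.charpoly.eval z * g z) A γ = 0 := by
  ext i j
  simp only [cauchyMatrix, Matrix.of_apply, Matrix.zero_apply]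
  have h1 : Set.EqOn
      (fun z => A.charpoly.eval z * g z * (z • (1 : Matrix (Fin n) (Fin n) ℂ) - A)⁻¹ i j)
      (fun z => g z * (z • (1 : Matrix (Fin n) (Fin n) ℂ) - A).adjugate i j) γ.carrier := by
    intro z hz
    have hd := det_ne_zero_of_notMem_spectrum A (z := z) fun hs => hz.2.2.2 (h hs)
    simp only [eval_charpoly_eq_det, inv_apply_eq]
    field_simp
  rw [γ.integral_congr h1, γ.integral_eq_zero, mul_zero]
  exact hg.mul (differentiable_adjugate (differentiable_smul_one_sub A) i j).differentiableOn

end CauchyMatrix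

/-! ### The holomorphic functional calculus and its powers -/

/-- Division with remainder of a holomorphic function by a polynomial with given roots. -/
theorem exists_eval_add_prod_mul {f : ℂ → ℂ} (hf : DifferentiableOn ℂ f Complex.slitPlane)
    (s : Multiset ℂ) (hs : ∀ a ∈ s, a ∈ Complex.slitPlane) :
    ∃ (p : Polynomial ℂ) (g : ℂ → ℂ), DifferentiableOn ℂ g Complex.slitPlane ∧
      ∀ z, f z = p.eval z +
        ((s.map fun a => Polynomial.X - Polynomial.C a).prod).eval z * g z := by
  induction s using Multiset.induction_on with
  | empty => exact ⟨0, f, hf, fun z => by simp⟩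
  | cons a s ih =>
    obtain ⟨p, g, hg, hfg⟩ := ih fun b hb => hs b (Multiset.mem_cons_of_mem hb)
    have ha : Complex.slitPlane ∈ nhds a :=
      Complex.isOpen_slitPlane.mem_nhds (hs a (Multiset.mem_cons_self a s))
    -- Newton interpolation: one root is split off at a time by `g z = g a + (z - a) * dslope g a
    -- z`, which also covers repeated roots.
    refine ⟨p + (s.map fun a => Polynomial.X - Polynomial.C a).prod * Polynomial.C (g a),
      dslope g a, (Complex.differentiableOn_dslope ha).2 hg, fun z => ?_⟩
    have h1 := sub_smul_dslope g a z
    rw [smul_eq_mul] at h1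
    simp only [Multiset.map_cons, Multiset.prod_cons, Polynomial.eval_add, Polynomial.eval_mul,
      Polynomial.eval_sub, Polynomial.eval_X, Polynomial.eval_C, hfg z]
    linear_combination (-(Multiset.map (fun a => Polynomial.X - Polynomial.C a) s).prod.eval z) * h1

section MatrixFun

variable {n : ℕ} {A : Matrix (Fin n) (Fin n) ℂ}

theorem exists_keyholeContour (h : spectrum ℂ A ⊆ Complex.slitPlane) :
    ∃ γ : KeyholeContour, spectrum ℂ A ⊆ γ.inside := by
  have hfin : (spectrum ℂ A).Finite := Matrix.finite_spectrum A
  obtain ⟨R, hR⟩ := hfin.isCompact.isBounded.exists_norm_le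
  have hr : ∃ r : ℝ, 0 < r ∧ ∀ z ∈ spectrum ℂ A, r < ‖z‖ := by
    rcases (spectrum ℂ A).eq_empty_or_nonempty with he | hne
    · exact ⟨1, one_pos, by simp [he]⟩
    · obtain ⟨z₀, hz₀, hmin⟩ := Set.exists_min_image _ (fun z : ℂ => ‖z‖) hfin hne
      have : 0 < ‖z₀‖ := norm_pos_iff.2 (Complex.slitPlane_ne_zero (h hz₀))
      exact ⟨‖z₀‖ / 2, by linarith, fun z hz => by linarith [hmin z hz]⟩
  have hθ : ∃ θ : ℝ, 0 < θ ∧ θ < Real.pi ∧ ∀ z ∈ spectrum ℂ A, |z.arg| < θ := by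
    rcases (spectrum ℂ A).eq_empty_or_nonempty with he | hne
    · exact ⟨1, one_pos, by linarith [Real.pi_gt_three], by simp [he]⟩
    · obtain ⟨z₀, hz₀, hmax⟩ := Set.exists_max_image _ (fun z : ℂ => |z.arg|) hfin hne
      have : |z₀.arg| < Real.pi := (Complex.abs_arg_le_pi z₀).lt_of_ne fun h' => by
        rw [abs_eq Real.pi_pos.le] at h'
        rcases h' with h' | h'
        · exact Complex.slitPlane_arg_ne_pi (h hz₀) h'
        · linarith [Complex.neg_pi_lt_arg z₀]
      exact ⟨(|z₀.arg| + Real.pi) / 2, by linarith [abs_nonneg z₀.arg, Real.pi_pos], by linarith,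
        fun z hz => by linarith [hmax z hz]⟩
  obtain ⟨r, hr0, hr⟩ := hr
  obtain ⟨θ, hθ0, hθ1, hθ⟩ := hθ
  exact ⟨⟨r, max R r + 1, θ, hr0, by linarith [le_max_right R r], hθ0, hθ1⟩, fun z hz =>
    ⟨hr z hz, by show ‖z‖ < max R r + 1; linarith [hR z hz, le_max_left R r], hθ z hz⟩⟩

theorem exists_matrixFun_eq (h : spectrum ℂ A ⊆ Complex.slitPlane) :
    ∃ γ : KeyholeContour, spectrum ℂ A ⊆ γ.inside ∧ ∀ f, matrixFun f A = cauchyMatrix f A γ := by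
  have hγ := exists_keyholeContour h
  exact ⟨hγ.choose, hγ.choose_spec, fun f => by rw [matrixFun, dif_pos hγ]⟩

theorem matrixFun_congr (h : spectrum ℂ A ⊆ Complex.slitPlane) {f g : ℂ → ℂ}
    (hfg : Set.EqOn f g Complex.slitPlane) : matrixFun f A = matrixFun g A := by
  obtain ⟨γ, -, hγ'⟩ := exists_matrixFun_eq h
  rw [hγ', hγ', cauchyMatrix_congr hfg]

theorem matrixFun_eval (h : spectrum ℂ A ⊆ Complex.slitPlane) (p : Polynomial ℂ) :
    matrixFun (fun z => p.eval z) A = Polynomial.aeval A p := by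
  obtain ⟨γ, hγ, hγ'⟩ := exists_matrixFun_eq h
  rw [hγ', cauchyMatrix_eval hγ]

/-- If `f` is the sum of a polynomial `p` and a holomorphic multiple of the characteristic
polynomial of `A`, then `f(A) = p(A)`. -/
theorem matrixFun_eq_aeval (h : spectrum ℂ A ⊆ Complex.slitPlane) {f g : ℂ → ℂ}
    {p : Polynomial ℂ} (hg : DifferentiableOn ℂ g Complex.slitPlane)
    (hfg : ∀ z, f z = p.eval z + A.charpoly.eval z * g z) :
    matrixFun f A = Polynomial.aeval A p := by
  obtain ⟨γ, hγ, hγ'⟩ := exists_matrixFun_eq h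
  have hc : ContinuousOn (fun z => A.charpoly.eval z * g z) Complex.slitPlane :=
    A.charpoly.continuous.continuousOn.mul hg.continuousOn
  rw [funext hfg, hγ', cauchyMatrix_add hγ p.continuous.continuousOn hc, cauchyMatrix_eval hγ,
    cauchyMatrix_charpoly_mul hγ hg, add_zero]

theorem exists_eval_add_charpoly_mul (h : spectrum ℂ A ⊆ Complex.slitPlane) {f : ℂ → ℂ}
    (hf : DifferentiableOn ℂ f Complex.slitPlane) :
    ∃ (p : Polynomial ℂ) (g : ℂ → ℂ), DifferentiableOn ℂ g Complex.slitPlane ∧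
      ∀ z, f z = p.eval z + A.charpoly.eval z * g z := by
  obtain ⟨p, g, hg, hfg⟩ := exists_eval_add_prod_mul hf A.charpoly.roots fun a ha =>
    h ((Matrix.mem_spectrum_iff_isRoot_charpoly).2
      ((Polynomial.mem_roots A.charpoly_monic.ne_zero).1 ha))
  refine ⟨p, g, hg, fun z => ?_⟩
  rw [hfg z, ← (IsAlgClosed.splits A.charpoly).eq_prod_roots_of_monic A.charpoly_monic]

/-- Modulo the characteristic polynomial each function is a polynomial, and the product of the two
remainders differs from `f g` by another holomorphic multiple of the characteristic polynomial.
Multiplicativity is thus reduced to that of `Polynomial.aeval`. -/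
theorem matrixFun_mul (h : spectrum ℂ A ⊆ Complex.slitPlane) {f g : ℂ → ℂ}
    (hf : DifferentiableOn ℂ f Complex.slitPlane) (hg : DifferentiableOn ℂ g Complex.slitPlane) :
    matrixFun (fun z => f z * g z) A = matrixFun f A * matrixFun g A := by
  obtain ⟨p, u, hu, hfu⟩ := exists_eval_add_charpoly_mul h hf
  obtain ⟨q, v, hv, hgv⟩ := exists_eval_add_charpoly_mul h hg
  rw [matrixFun_eq_aeval h hu hfu, matrixFun_eq_aeval h hv hgv, ← map_mul]
  have hp : DifferentiableOn ℂ (fun z => p.eval z) Complex.slitPlane :=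
    p.differentiable.differentiableOn
  have hq : DifferentiableOn ℂ (fun z => q.eval z) Complex.slitPlane :=
    q.differentiable.differentiableOn
  have hc : DifferentiableOn ℂ (fun z => A.charpoly.eval z) Complex.slitPlane :=
    A.charpoly.differentiable.differentiableOn
  refine matrixFun_eq_aeval h
    (g := fun z => p.eval z * v z + u z * q.eval z + A.charpoly.eval z * u z * v z)
    (((hp.mul hv).add (hu.mul hq)).add ((hc.mul hu).mul hv)) fun z => ?_
  rw [hfu z, hgv z, Polynomial.eval_mul]
  ring

theorem differentiableOn_cpow_slitPlane (s : ℂ) :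
    DifferentiableOn ℂ (fun z : ℂ => z ^ s) Complex.slitPlane := fun _ hz =>
  (DifferentiableAt.cpow_const (f := fun z : ℂ => z) differentiableAt_id hz).differentiableWithinAt

theorem matrixPow_zero (h : spectrum ℂ A ⊆ Complex.slitPlane) : matrixPow A 0 = 1 := by
  have := matrixFun_eval h 1
  simpa [matrixPow] using this

theorem matrixPow_one (h : spectrum ℂ A ⊆ Complex.slitPlane) : matrixPow A 1 = A := by
  have := matrixFun_eval h Polynomial.X
  simpa [matrixPow] using this

theorem matrixPow_add (h : spectrum ℂ A ⊆ Complex.slitPlane) (s t : ℝ) :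
    matrixPow A (s + t) = matrixPow A s * matrixPow A t := by
  rw [matrixPow, matrixPow, matrixPow, ← matrixFun_mul h (differentiableOn_cpow_slitPlane s)
    (differentiableOn_cpow_slitPlane t)]
  refine matrixFun_congr h fun z hz => ?_
  simp only [Complex.ofReal_add]
  exact Complex.cpow_add _ _ (Complex.slitPlane_ne_zero hz)

end MatrixFun

/-! ### The integral representation of `z ^ t` on the slit plane -/

/-- The slit plane is star-shaped about `1`, so `u + (1 - u) z` does not vanish on the compact set
`[0, 1] × K`; its minimal modulus serves as `δ`. The bound is the uniform control of `1/(s+z)`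
behind all the domination arguments for the kernel. -/
theorem exists_le_norm_add_of_isCompact {K : Set ℂ} (hK : IsCompact K)
    (hKs : K ⊆ Complex.slitPlane) :
    ∃ δ : ℝ, 0 < δ ∧ ∀ z ∈ K, ∀ s : ℝ, 0 ≤ s → δ * (1 + s) ≤ ‖(s : ℂ) + z‖ := by
  rcases K.eq_empty_or_nonempty with rfl | hne
  · exact ⟨1, one_pos, by simp⟩
  obtain ⟨⟨u₀, z₀⟩, ⟨hu₀, hz₀⟩, hmin⟩ := (isCompact_Icc (a := (0 : ℝ)) (b := 1)).prod hK
    |>.exists_isMinOn ((Set.nonempty_Icc.2 zero_le_one).prod hne)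
    (f := fun p : ℝ × ℂ => ‖(p.1 : ℂ) + (1 - p.1) * p.2‖) (by fun_prop)
  refine ⟨‖(u₀ : ℂ) + (1 - u₀) * z₀‖, norm_pos_iff.2 (Complex.slitPlane_ne_zero ?_), ?_⟩
  · have := Complex.starConvex_one_slitPlane (hKs hz₀) hu₀.1 (sub_nonneg.2 hu₀.2) (by ring)
    simpa using this
  · intro z hz s hs
    have h1 : 0 < 1 + s := by linarith
    -- The half-line is compactified by `u = s / (1 + s)`, for which `s + z = (1 + s) (u + (1 - u)
    -- z)`.
    have h2 := hmin (a := (s / (1 + s), z))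
      ⟨⟨by positivity, (div_le_one h1).2 (by linarith)⟩, hz⟩
    simp only [Set.mem_ofPred_eq] at h2
    have h3 : (s : ℂ) + z =
        ((1 + s : ℝ) : ℂ) * (((s / (1 + s) : ℝ) : ℂ) + (1 - ((s / (1 + s) : ℝ) : ℂ)) * z) := by
      have : (1 + s : ℂ) ≠ 0 := by exact_mod_cast h1.ne'
      push_cast
      field_simp
      ring
    rw [h3, norm_mul, Complex.norm_real, Real.norm_of_nonneg h1.le, mul_comm]
    exact mul_le_mul_of_nonneg_left h2 h1.le

theorem add_ne_zero_of_mem_slitPlane {z : ℂ} (hz : z ∈ Complex.slitPlane) {s : ℝ} (hs : 0 ≤ s) :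
    (s : ℂ) + z ≠ 0 := by
  intro h
  rw [add_comm, add_eq_zero_iff_eq_neg] at h
  rw [h, Complex.mem_slitPlane_iff] at hz
  simp at hz
  linarith

/-- The integrand `s ^ (t - 1) * z / (s + z)` of the integral representation of `z ^ t`. -/
noncomputable def cpowKernel (t s : ℝ) (z : ℂ) : ℂ := ((s ^ (t - 1) : ℝ) : ℂ) * (z / (s + z))

theorem integrableOn_rpow_div_one_add {t : ℝ} (ht : t ∈ Set.Ioo (0 : ℝ) 1) :
    MeasureTheory.IntegrableOn (fun s : ℝ => s ^ (t - 1) / (1 + s)) (Set.Ioi 0) := by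
  refine (Real.integrableOn_rpowIntegrand₀₁_Ioi ht zero_le_one).congr_fun (fun s hs => ?_)
    measurableSet_Ioi
  simp only [Real.rpowIntegrand₀₁_eq_pow_div ht (le_of_lt hs) zero_le_one, mul_one, add_comm]

theorem norm_cpowKernel_le {t s δ B : ℝ} {z : ℂ} (hs : 0 < s) (hδ : 0 < δ)
    (h : δ * (1 + s) ≤ ‖(s : ℂ) + z‖) (hB : ‖z‖ ≤ B) :
    ‖cpowKernel t s z‖ ≤ B / δ * (s ^ (t - 1) / (1 + s)) := by
  have h1 : 0 < δ * (1 + s) := by positivity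
  have h2 : 0 ≤ s ^ (t - 1) := by positivity
  have h3 : 0 ≤ B := (norm_nonneg z).trans hB
  rw [cpowKernel, norm_mul, norm_div, Complex.norm_real, Real.norm_of_nonneg h2]
  calc s ^ (t - 1) * (‖z‖ / ‖(s : ℂ) + z‖) ≤ s ^ (t - 1) * (B / (δ * (1 + s))) := by gcongr
    _ = _ := by field_simp

theorem continuousOn_cpowKernel (t : ℝ) :
    ContinuousOn (fun p : ℝ × ℂ => cpowKernel t p.1 p.2) (Set.Ioi 0 ×ˢ Complex.slitPlane) := by
  unfold cpowKernel
  refine ContinuousOn.mul ?_ (ContinuousOn.div (by fun_prop) (by fun_prop) fun p hp =>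
    add_ne_zero_of_mem_slitPlane hp.2 (le_of_lt hp.1))
  refine Complex.continuous_ofReal.comp_continuousOn ?_
  exact ContinuousOn.rpow_const (by fun_prop) fun p hp => Or.inl (ne_of_gt hp.1)

theorem aestronglyMeasurable_cpowKernel (t : ℝ) {z : ℂ} (hz : z ∈ Complex.slitPlane) :
    MeasureTheory.AEStronglyMeasurable (fun s => cpowKernel t s z)
      (MeasureTheory.volume.restrict (Set.Ioi 0)) :=
  ((continuousOn_cpowKernel t).comp (f := fun s : ℝ => (s, z)) (by fun_prop)
    fun _ hs => ⟨hs, hz⟩).aestronglyMeasurable measurableSet_Ioi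

theorem integrableOn_cpowKernel {t : ℝ} (ht : t ∈ Set.Ioo (0 : ℝ) 1) {z : ℂ}
    (hz : z ∈ Complex.slitPlane) :
    MeasureTheory.IntegrableOn (fun s => cpowKernel t s z) (Set.Ioi 0) := by
  obtain ⟨δ, hδ, h⟩ := exists_le_norm_add_of_isCompact (isCompact_singleton (x := z))
    (Set.singleton_subset_iff.2 hz)
  refine ((integrableOn_rpow_div_one_add ht).const_mul (‖z‖ / δ)).mono'
    (aestronglyMeasurable_cpowKernel t hz) ?_
  refine (MeasureTheory.ae_restrict_iff' measurableSet_Ioi).2 (.of_forall fun s hs => ?_)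
  exact norm_cpowKernel_le hs hδ (h z rfl s (le_of_lt hs)) le_rfl

/-- Differentiation under the integral sign: the derivative of `z/(s+z)` is `s/(s+z)²`, dominated
near `z₀` by `δ⁻² / (1 + s)`. -/
theorem differentiableOn_integral_cpowKernel {t : ℝ} (ht : t ∈ Set.Ioo (0 : ℝ) 1) :
    DifferentiableOn ℂ (fun z => ∫ s in Set.Ioi (0 : ℝ), cpowKernel t s z) Complex.slitPlane := by
  intro z₀ hz₀
  obtain ⟨ε, hε, hball⟩ := Metric.nhds_basis_closedBall.mem_iff.1
    (Complex.isOpen_slitPlane.mem_nhds hz₀)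
  obtain ⟨δ, hδ, h⟩ := exists_le_norm_add_of_isCompact (isCompact_closedBall z₀ ε) hball
  have key := hasDerivAt_integral_of_dominated_loc_of_deriv_le
    (μ := MeasureTheory.volume.restrict (Set.Ioi (0 : ℝ))) (F := fun z s => cpowKernel t s z)
    (F' := fun z s => ((s ^ (t - 1) : ℝ) : ℂ) * (s / (s + z) ^ 2)) (x₀ := z₀)
    (s := Metric.closedBall z₀ ε) (bound := fun s => (δ ^ 2)⁻¹ * (s ^ (t - 1) / (1 + s)))
    (Metric.closedBall_mem_nhds z₀ hε)
    (Filter.eventually_of_mem (Complex.isOpen_slitPlane.mem_nhds hz₀) fun z hz =>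
      aestronglyMeasurable_cpowKernel t hz)
    (integrableOn_cpowKernel ht hz₀) ?_ ?_ ((integrableOn_rpow_div_one_add ht).const_mul _) ?_
  · exact key.2.differentiableAt.differentiableWithinAt
  · refine ContinuousOn.aestronglyMeasurable ?_ measurableSet_Ioi
    refine ContinuousOn.mul (Complex.continuous_ofReal.comp_continuousOn
      (ContinuousOn.rpow_const (by fun_prop) fun p hp => Or.inl (ne_of_gt hp)))
      (ContinuousOn.div (by fun_prop) (by fun_prop) fun s hs => ?_)
    exact pow_ne_zero _ (add_ne_zero_of_mem_slitPlane hz₀ (le_of_lt hs))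
  · refine (MeasureTheory.ae_restrict_iff' measurableSet_Ioi).2 (.of_forall fun s hs z hz => ?_)
    have hs0 : 0 < s := hs
    have h1 : 0 < δ * (1 + s) := by positivity
    have h2 : 0 ≤ s ^ (t - 1) := by positivity
    rw [norm_mul, norm_div, norm_pow, Complex.norm_real, Complex.norm_real,
      Real.norm_of_nonneg h2, Real.norm_of_nonneg hs0.le]
    calc s ^ (t - 1) * (s / ‖(s : ℂ) + z‖ ^ 2)
        ≤ s ^ (t - 1) * ((1 + s) / (δ * (1 + s)) ^ 2) := by
          gcongr
          · linarith
          · exact h z hz s hs0.le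
      _ = _ := by field_simp
  · refine (MeasureTheory.ae_restrict_iff' measurableSet_Ioi).2 (.of_forall fun s hs z hz => ?_)
    have hne := add_ne_zero_of_mem_slitPlane (hball hz) (le_of_lt hs)
    have := ((hasDerivAt_id z).div ((hasDerivAt_id z).const_add (s : ℂ)) hne).const_mul
      ((s ^ (t - 1) : ℝ) : ℂ)
    refine this.congr_deriv ?_
    simp

/-- The normalizing constant of the integral representation of `z ^ t`. -/
noncomputable def cpowConst (t : ℝ) : ℝ := (∫ s in Set.Ioi (0 : ℝ), Real.rpowIntegrand₀₁ t s 1)⁻¹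

theorem cpowConst_pos {t : ℝ} (ht : t ∈ Set.Ioo (0 : ℝ) 1) : 0 < cpowConst t :=
  inv_pos.2 (Real.integral_rpowIntegrand₀₁_one_pos ht)

theorem ofReal_cpow_eq_integral {t : ℝ} (ht : t ∈ Set.Ioo (0 : ℝ) 1) {x : ℝ} (hx : 0 < x) :
    (x : ℂ) ^ (t : ℂ) = cpowConst t * ∫ s in Set.Ioi (0 : ℝ), cpowKernel t s x := by
  rw [← Complex.ofReal_cpow hx.le, Real.rpow_eq_const_mul_integral ht hx.le, Complex.ofReal_mul,
    ← integral_complex_ofReal]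
  refine congrArg₂ _ rfl (MeasureTheory.setIntegral_congr_fun measurableSet_Ioi fun s hs => ?_)
  simp only [Real.rpowIntegrand₀₁_eq_pow_div ht (le_of_lt hs) hx.le, cpowKernel]
  push_cast
  ring

/-- Both sides are analytic on the connected slit plane and agree on the positive reals, which
accumulate at `1`; the identity theorem does the rest. -/
theorem cpow_eq_integral {t : ℝ} (ht : t ∈ Set.Ioo (0 : ℝ) 1) {z : ℂ}
    (hz : z ∈ Complex.slitPlane) :
    z ^ (t : ℂ) = cpowConst t * ∫ s in Set.Ioi (0 : ℝ), cpowKernel t s z := by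
  have h1 : AnalyticOnNhd ℂ (fun z : ℂ => z ^ (t : ℂ)) Complex.slitPlane :=
    (differentiableOn_cpow_slitPlane t).analyticOnNhd Complex.isOpen_slitPlane
  have h2 : AnalyticOnNhd ℂ
      (fun z => cpowConst t * ∫ s in Set.Ioi (0 : ℝ), cpowKernel t s z) Complex.slitPlane :=
    ((differentiableOn_integral_cpowKernel ht).const_mul _).analyticOnNhd Complex.isOpen_slitPlane
  refine h1.eqOn_of_preconnected_of_frequently_eq h2
    (Complex.starConvex_one_slitPlane.isPathConnected Complex.one_mem_slitPlane
      ).isConnected.isPreconnected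
    Complex.one_mem_slitPlane ?_ hz
  have ht1 : Filter.Tendsto (fun x : ℝ => (x : ℂ)) (nhdsWithin 1 {1}ᶜ) (nhdsWithin 1 {1}ᶜ) := by
    refine tendsto_nhdsWithin_of_tendsto_nhds_of_eventually_within _ ?_ ?_
    · exact (Complex.continuous_ofReal.tendsto' 1 1 (by simp)).mono_left nhdsWithin_le_nhds
    · filter_upwards [self_mem_nhdsWithin] with x hx
      simpa using hx
  refine ht1.frequently (Filter.Eventually.frequently ?_)
  filter_upwards [nhdsWithin_le_nhds (Ioi_mem_nhds (zero_lt_one (α := ℝ)))] with x hx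
  exact ofReal_cpow_eq_integral ht hx

/-! ### Exchanging the contour integral with the integral over `s` -/

namespace KeyholeContour

/-- The image of the parameter interval is compact in the slit plane, so the kernel has one bound
for all points of the curve, and a constant times an integrable function of `s` dominates the
integrand. -/
theorem integrable_prod_cpowKernel {t : ℝ} (ht : t ∈ Set.Ioo (0 : ℝ) 1) {c h : ℝ → ℂ} {a b : ℝ}
    (hc : ContinuousOn c (Set.uIcc a b)) (hh : ContinuousOn h (Set.uIcc a b))
    (hm : ∀ u ∈ Set.uIcc a b, c u ∈ Complex.slitPlane) :
    MeasureTheory.Integrable (Function.uncurry fun u s => cpowKernel t s (c u) * h u)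
      ((MeasureTheory.volume.restrict (Set.uIoc a b)).prod
        (MeasureTheory.volume.restrict (Set.Ioi (0 : ℝ)))) := by
  obtain ⟨δ, hδ, hδ'⟩ := exists_le_norm_add_of_isCompact (isCompact_uIcc.image_of_continuousOn hc)
    (Set.image_subset_iff.2 hm)
  obtain ⟨B, hB⟩ := isCompact_uIcc.exists_bound_of_continuousOn hc
  obtain ⟨H, hH⟩ := isCompact_uIcc.exists_bound_of_continuousOn hh
  have hw := (integrableOn_rpow_div_one_add ht).const_mul (B / δ)
  have h1 : MeasureTheory.Integrable (fun _ : ℝ => H)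
      (MeasureTheory.volume.restrict (Set.uIoc a b)) := by
    rw [Set.uIoc]
    exact MeasureTheory.integrableOn_const (by simp)
  refine (h1.mul_prod hw).mono' ?_ ?_
  · rw [MeasureTheory.Measure.prod_restrict]
    refine ContinuousOn.aestronglyMeasurable ?_ (measurableSet_uIoc.prod measurableSet_Ioi)
    have hsub : Set.uIoc a b ×ˢ Set.Ioi (0 : ℝ) ⊆ Set.uIcc a b ×ˢ Set.Ioi (0 : ℝ) :=
      Set.prod_mono Set.uIoc_subset_uIcc subset_rfl
    refine ContinuousOn.mono (ContinuousOn.mul ?_ ?_) hsub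
    · refine (continuousOn_cpowKernel t).comp (f := fun p : ℝ × ℝ => (p.2, c p.1))
        (continuousOn_snd.prodMk (hc.comp continuousOn_fst fun p hp => hp.1))
        fun p hp => ⟨hp.2, hm _ hp.1⟩
    · exact hh.comp continuousOn_fst fun p hp => hp.1
  · rw [MeasureTheory.Measure.prod_restrict]
    refine (MeasureTheory.ae_restrict_iff' (measurableSet_uIoc.prod measurableSet_Ioi)).2
      (.of_forall fun p hp => ?_)
    have hp1 := Set.uIoc_subset_uIcc hp.1
    have hp2 : 0 < p.2 := hp.2
    have hk := norm_cpowKernel_le (t := t) hp2 hδ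
      (hδ' _ (Set.mem_image_of_mem c hp1) p.2 hp2.le) (hB _ hp1)
    rw [Function.uncurry, norm_mul, mul_comm]
    exact mul_le_mul (hH _ hp1) hk (norm_nonneg _) ((norm_nonneg _).trans (hH _ hp1))

theorem integrableOn_integral_cpowKernel (γ : KeyholeContour) {t : ℝ}
    (ht : t ∈ Set.Ioo (0 : ℝ) 1) {h : ℂ → ℂ} (hh : ContinuousOn h γ.carrier) :
    MeasureTheory.IntegrableOn (fun s => γ.integral fun z => cpowKernel t s z * h z) (Set.Ioi 0) ∧
      γ.integral (fun z => (∫ s in Set.Ioi (0 : ℝ), cpowKernel t s z) * h z) =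
        ∫ s in Set.Ioi (0 : ℝ), γ.integral fun z => cpowKernel t s z * h z := by
  obtain ⟨c, c', a, b, ε, hc, hc', hm, hi⟩ := γ.exists_curves
  have hint := fun k => integrable_prod_cpowKernel ht (a := a k) (b := b k) (hc k).continuousOn
    (((hh.comp (hc k).continuousOn (hm k)).mul (hc' k).continuousOn))
    fun u hu => γ.carrier_subset_slitPlane (hm k u hu)
  have hint' : ∀ k, MeasureTheory.IntegrableOn (fun s => ε k *
      parametrizedIntegral (c k) (c' k) (a k) (b k) fun z => cpowKernel t s z * h z)
      (Set.Ioi 0) := by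
    intro k
    refine MeasureTheory.Integrable.const_mul ?_ _
    simp only [parametrizedIntegral, intervalIntegral.intervalIntegral_eq_integral_uIoc]
    refine MeasureTheory.Integrable.smul _ ?_
    have := (hint k).integral_prod_right
    simpa only [Function.uncurry, Pi.mul_apply, Function.comp, ← mul_assoc] using this
  simp only [hi]
  refine ⟨MeasureTheory.integrable_finsetSum _ fun k _ => hint' k, ?_⟩
  rw [MeasureTheory.integral_finsetSum _ fun k _ => hint' k]
  refine Finset.sum_congr rfl fun k _ => ?_
  rw [MeasureTheory.integral_const_mul]
  congr 1
  have := MeasureTheory.intervalIntegral_integral_swap (hint k)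
  simp only [parametrizedIntegral]
  simp only [Pi.mul_apply, Function.comp, ← mul_assoc] at this
  rw [← this]
  refine intervalIntegral.integral_congr fun u _ => ?_
  simp only [mul_assoc]
  rw [MeasureTheory.integral_mul_const]

end KeyholeContour

/-! ### The integral representation of matrix powers -/

section MatrixPow

variable {n : ℕ} {M : Matrix (Fin n) (Fin n) ℂ}

theorem isUnit_det_smul_one_add (h : spectrum ℂ M ⊆ Complex.slitPlane) {s : ℝ} (hs : 0 ≤ s) :
    IsUnit ((s : ℂ) • (1 : Matrix (Fin n) (Fin n) ℂ) + M).det := by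
  have h1 := det_ne_zero_of_notMem_spectrum M (z := -(s : ℂ)) fun hz =>
    add_ne_zero_of_mem_slitPlane (h hz) hs (by simp)
  have h2 : (s : ℂ) • (1 : Matrix (Fin n) (Fin n) ℂ) + M =
      -(-(s : ℂ) • (1 : Matrix (Fin n) (Fin n) ℂ) - M) := by
    rw [neg_smul]; abel
  rw [h2, Matrix.det_neg, isUnit_iff_ne_zero]
  exact mul_ne_zero (pow_ne_zero _ (by simp)) h1

theorem matrixFun_div_add (h : spectrum ℂ M ⊆ Complex.slitPlane) {s : ℝ} (hs : 0 ≤ s) :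
    matrixFun (fun z => z / (s + z)) M =
      M * ((s : ℂ) • (1 : Matrix (Fin n) (Fin n) ℂ) + M)⁻¹ := by
  have h1 := matrixFun_eval h (Polynomial.C (s : ℂ) + Polynomial.X)
  have h2 := matrixFun_eval h Polynomial.X
  have h3 := matrixFun_mul h (f := fun z => z / (s + z))
    (g := fun z => (Polynomial.C (s : ℂ) + Polynomial.X).eval z)
    (DifferentiableOn.div (by fun_prop) (by fun_prop) fun z hz =>
      add_ne_zero_of_mem_slitPlane hz hs) (Polynomial.differentiable _).differentiableOn
  rw [h1, matrixFun_congr h (g := fun z => Polynomial.X.eval z) fun z hz => by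
    simp [div_mul_cancel₀ _ (add_ne_zero_of_mem_slitPlane hz hs)], h2] at h3
  simp only [Polynomial.aeval_X, map_add, Polynomial.aeval_C, Algebra.algebraMap_eq_smul_one] at h3
  calc matrixFun (fun z => z / (s + z)) M
      = matrixFun (fun z => z / (s + z)) M * ((s : ℂ) • (1 : Matrix (Fin n) (Fin n) ℂ) + M) *
          ((s : ℂ) • (1 : Matrix (Fin n) (Fin n) ℂ) + M)⁻¹ :=
        (Matrix.mul_nonsing_inv_cancel_right _ _ (isUnit_det_smul_one_add h hs)).symm
    _ = _ := by rw [← h3]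

/-- For fixed `s` the Cauchy integral of `z/(s+z)` is `M (sI + M)⁻¹`; Fubini moves the integral over
`s` outside the contour integral. -/
theorem matrixPow_apply_eq_integral (h : spectrum ℂ M ⊆ Complex.slitPlane) {t : ℝ}
    (ht : t ∈ Set.Ioo (0 : ℝ) 1) (i j : Fin n) :
    MeasureTheory.IntegrableOn (fun s : ℝ => ((s ^ (t - 1) : ℝ) : ℂ) *
      (M * ((s : ℂ) • (1 : Matrix (Fin n) (Fin n) ℂ) + M)⁻¹) i j) (Set.Ioi 0) ∧
    matrixPow M t i j = cpowConst t * ∫ s in Set.Ioi (0 : ℝ), ((s ^ (t - 1) : ℝ) : ℂ) *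
      (M * ((s : ℂ) • (1 : Matrix (Fin n) (Fin n) ℂ) + M)⁻¹) i j := by
  obtain ⟨γ, hγ, hγ'⟩ := exists_matrixFun_eq h
  have hres := continuousOn_resolvent_apply hγ i j
  obtain ⟨h1, h2⟩ := γ.integrableOn_integral_cpowKernel ht hres
  have h3 : Set.EqOn (fun s : ℝ => (2 * Real.pi * Complex.I : ℂ)⁻¹ *
        γ.integral fun z => cpowKernel t s z * (z • (1 : Matrix (Fin n) (Fin n) ℂ) - M)⁻¹ i j)
      (fun s : ℝ => ((s ^ (t - 1) : ℝ) : ℂ) *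
        (M * ((s : ℂ) • (1 : Matrix (Fin n) (Fin n) ℂ) + M)⁻¹) i j) (Set.Ioi 0) := by
    intro s hs
    simp only [cpowKernel, mul_assoc]
    rw [γ.integral_const_mul, ← matrixFun_div_add h (le_of_lt hs), hγ', cauchyMatrix,
      Matrix.of_apply]
    ring
  refine ⟨MeasureTheory.IntegrableOn.congr_fun (h1.const_mul _) h3 measurableSet_Ioi, ?_⟩
  rw [← MeasureTheory.setIntegral_congr_fun measurableSet_Ioi h3,
    MeasureTheory.integral_const_mul, ← h2, matrixPow, hγ', cauchyMatrix, Matrix.of_apply,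
    γ.integral_congr (h := fun z => (cpowConst t : ℂ) *
      ((∫ s in Set.Ioi (0 : ℝ), cpowKernel t s z) *
        (z • (1 : Matrix (Fin n) (Fin n) ℂ) - M)⁻¹ i j)) fun z hz => by
      simp only [cpow_eq_integral ht (γ.carrier_subset_slitPlane hz), mul_assoc],
    γ.integral_const_mul]
  ring

/-- A linear functional is a finite combination of matrix entries. With `N ↦ ⟨S N S x, x⟩` as the
functional, everything later takes place in scalar integrals. -/
theorem map_matrixPow_eq_integral (h : spectrum ℂ M ⊆ Complex.slitPlane) {t : ℝ}
    (ht : t ∈ Set.Ioo (0 : ℝ) 1) (φ : Matrix (Fin n) (Fin n) ℂ →ₗ[ℂ] ℂ) :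
    MeasureTheory.IntegrableOn (fun s : ℝ => ((s ^ (t - 1) : ℝ) : ℂ) *
      φ (M * ((s : ℂ) • (1 : Matrix (Fin n) (Fin n) ℂ) + M)⁻¹)) (Set.Ioi 0) ∧
    φ (matrixPow M t) = cpowConst t * ∫ s in Set.Ioi (0 : ℝ), ((s ^ (t - 1) : ℝ) : ℂ) *
      φ (M * ((s : ℂ) • (1 : Matrix (Fin n) (Fin n) ℂ) + M)⁻¹) := by
  have hφ : ∀ N, φ N = ∑ i, ∑ j, N i j * φ (Matrix.single i j 1) := by
    intro N
    conv_lhs => rw [Matrix.matrix_eq_sum_single N]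
    simp only [map_sum]
    refine Finset.sum_congr rfl fun i _ => Finset.sum_congr rfl fun j _ => ?_
    rw [← smul_eq_mul, ← map_smul, Matrix.smul_single, smul_eq_mul, mul_one]
  have hij := fun i j => matrixPow_apply_eq_integral h ht i j
  have hint := fun i j => (hij i j).1.mul_const (φ (Matrix.single i j 1))
  have heq : ∀ s : ℝ, ((s ^ (t - 1) : ℝ) : ℂ) *
      φ (M * ((s : ℂ) • (1 : Matrix (Fin n) (Fin n) ℂ) + M)⁻¹) = ∑ i, ∑ j,
      ((s ^ (t - 1) : ℝ) : ℂ) * (M * ((s : ℂ) • (1 : Matrix (Fin n) (Fin n) ℂ) + M)⁻¹) i j *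
        φ (Matrix.single i j 1) := by
    intro s
    rw [hφ]
    simp only [Finset.mul_sum, mul_assoc]
  simp only [heq]
  have hint' := fun i => MeasureTheory.integrable_finsetSum Finset.univ fun j _ => hint i j
  refine ⟨MeasureTheory.integrable_finsetSum _ fun i _ => hint' i, ?_⟩
  rw [hφ, MeasureTheory.integral_finsetSum _ fun i _ => hint' i, Finset.mul_sum]
  refine Finset.sum_congr rfl fun i _ => ?_
  rw [MeasureTheory.integral_finsetSum _ fun j _ => hint i j, Finset.mul_sum]
  refine Finset.sum_congr rfl fun j _ => ?_
  rw [(hij i j).2, MeasureTheory.integral_mul_const, mul_assoc]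

end MatrixPow

/-! ### Quadratic forms and strictly accretive matrices -/

section QuadForm

variable {n : ℕ}

/-- The quadratic form `⟨N x, x⟩` of a complex matrix. -/
def quadForm (N : Matrix (Fin n) (Fin n) ℂ) (x : Fin n → ℂ) : ℂ := star x ⬝ᵥ N.mulVec x

theorem quadForm_add (M N : Matrix (Fin n) (Fin n) ℂ) (x : Fin n → ℂ) :
    quadForm (M + N) x = quadForm M x + quadForm N x := by
  simp [quadForm, Matrix.add_mulVec, dotProduct_add]

theorem quadForm_sub (M N : Matrix (Fin n) (Fin n) ℂ) (x : Fin n → ℂ) :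
    quadForm (M - N) x = quadForm M x - quadForm N x := by
  simp [quadForm, Matrix.sub_mulVec, dotProduct_sub]

theorem quadForm_real_smul (r : ℝ) (N : Matrix (Fin n) (Fin n) ℂ) (x : Fin n → ℂ) :
    quadForm (r • N) x = r * quadForm N x := by
  simp [quadForm, Matrix.smul_mulVec, dotProduct_smul]

theorem quadForm_star (N : Matrix (Fin n) (Fin n) ℂ) (x : Fin n → ℂ) :
    quadForm (star N) x = star (quadForm N x) := by
  rw [quadForm, quadForm, Matrix.star_eq_conjTranspose, Matrix.star_dotProduct,
    Matrix.star_mulVec, Matrix.dotProduct_mulVec, Matrix.conjTranspose_conjTranspose]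

theorem quadForm_realPart (N : Matrix (Fin n) (Fin n) ℂ) (x : Fin n → ℂ) :
    quadForm (ℜ N : Matrix (Fin n) (Fin n) ℂ) x = ((quadForm N x).re : ℂ) := by
  rw [realPart_apply_coe, quadForm_real_smul, quadForm_add, quadForm_star]
  apply Complex.ext <;> simp
  ring

theorem quadForm_smul (N : Matrix (Fin n) (Fin n) ℂ) (k : ℂ) (x : Fin n → ℂ) :
    quadForm N (k • x) = star k * k * quadForm N x := by
  simp [quadForm, Matrix.mulVec_smul, dotProduct_smul, smul_dotProduct]
  ring

theorem quadForm_smul_sub (N : Matrix (Fin n) (Fin n) ℂ) (k : ℂ) (u y : Fin n → ℂ) :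
    quadForm N (k • u - y) = star k * k * quadForm N u + quadForm N y -
      k * (star y ⬝ᵥ N.mulVec u) - star k * (star u ⬝ᵥ N.mulVec y) := by
  simp [quadForm, Matrix.mulVec_smul, Matrix.mulVec_sub, dotProduct_smul, smul_dotProduct,
    dotProduct_sub, sub_dotProduct]
  ring

/-- A complex matrix with a real quadratic form is symmetric with respect to it. -/
theorem star_dotProduct_mulVec_of_quadForm_im_eq_zero {N : Matrix (Fin n) (Fin n) ℂ}
    (h : ∀ x, (quadForm N x).im = 0) (u y : Fin n → ℂ) :
    star u ⬝ᵥ N.mulVec y = star (star y ⬝ᵥ N.mulVec u) := by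
  -- Polarization: the vectors `u - y` and `i u - y` yield the imaginary and the real part of the
  -- identity, respectively.
  have h1 := h ((1 : ℂ) • u - y)
  have h2 := h (Complex.I • u - y)
  rw [quadForm_smul_sub] at h1 h2
  have hu := h u
  have hy := h y
  simp [hu, hy] at h1 h2
  apply Complex.ext
  · simp; linarith
  · simp; linarith

theorem isHermitian_of_quadForm_im_eq_zero {N : Matrix (Fin n) (Fin n) ℂ}
    (h : ∀ x, (quadForm N x).im = 0) : N.IsHermitian := by
  ext i j
  have := star_dotProduct_mulVec_of_quadForm_im_eq_zero h (Pi.single i 1) (Pi.single j 1)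
  simp at this
  rw [Matrix.conjTranspose_apply, this]
  simp

open scoped ComplexOrder in
theorem le_of_quadForm {M N : Matrix (Fin n) (Fin n) ℂ} (hM : ∀ x, (quadForm M x).im = 0)
    (hN : ∀ x, (quadForm N x).im = 0) (h : ∀ x, (quadForm M x).re ≤ (quadForm N x).re) :
    M ≤ N := by
  rw [Matrix.le_iff, Matrix.posSemidef_iff_dotProduct_mulVec]
  refine ⟨isHermitian_of_quadForm_im_eq_zero fun x => ?_, fun x => ?_⟩
  · rw [quadForm_sub, Complex.sub_im, hM, hN, sub_zero]
  · change 0 ≤ quadForm (N - M) x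
    rw [quadForm_sub, Complex.le_def]
    simp [hM, hN, h]

theorem exists_quadForm_eq_mul {x : Fin n → ℂ} (hx : x ≠ 0) : ∃ (r : ℝ) (y : Fin n → ℂ), 0 < r ∧
    star y ⬝ᵥ y = 1 ∧ ∀ N : Matrix (Fin n) (Fin n) ℂ, quadForm N x = r * quadForm N y := by
  set r : ℝ := ∑ i, ‖x i‖ ^ 2 with hrdef
  have hr : star x ⬝ᵥ x = r := by
    simp [dotProduct, hrdef, Complex.conj_mul']
  have hr0 : 0 < r := by
    obtain ⟨i, hi⟩ := Function.ne_iff.1 hx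
    exact Finset.sum_pos' (fun j _ => by positivity)
      ⟨i, Finset.mem_univ i, pow_pos (norm_pos_iff.2 hi) 2⟩
  set k : ℂ := (((Real.sqrt r)⁻¹ : ℝ) : ℂ) with hk
  have hkk : star k * k = ((r⁻¹ : ℝ) : ℂ) := by
    rw [hk, Complex.star_def, Complex.conj_ofReal, ← Complex.ofReal_mul, ← mul_inv,
      Real.mul_self_sqrt hr0.le]
  have hrr : (r : ℂ) * ((r⁻¹ : ℝ) : ℂ) = 1 := by
    rw [← Complex.ofReal_mul, mul_inv_cancel₀ hr0.ne', Complex.ofReal_one]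
  refine ⟨r, k • x, hr0, ?_, fun N => ?_⟩
  · have := quadForm_smul 1 k x
    simp only [quadForm, Matrix.one_mulVec] at this
    rw [this, hkk, hr, mul_comm, hrr]
  · rw [quadForm_smul, hkk, ← mul_assoc, hrr, one_mul]

/-- The quadratic form has positive real part away from the origin. -/
def IsStrictlyAccretive (N : Matrix (Fin n) (Fin n) ℂ) : Prop := ∀ x ≠ 0, 0 < (quadForm N x).re

theorem IsStrictlyAccretive.spectrum_subset {N : Matrix (Fin n) (Fin n) ℂ}
    (hN : IsStrictlyAccretive N) : spectrum ℂ N ⊆ Complex.slitPlane := by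
  intro z hz
  rw [Matrix.mem_spectrum_iff_isRoot_charpoly, Polynomial.IsRoot.def, eval_charpoly_eq_det,
    ← Matrix.exists_mulVec_eq_zero_iff] at hz
  obtain ⟨v, hv0, hv⟩ := hz
  rw [Matrix.sub_mulVec, Matrix.smul_mulVec, Matrix.one_mulVec, sub_eq_zero] at hv
  obtain ⟨r, y, hr, hy, hry⟩ := exists_quadForm_eq_mul hv0
  have h1 := hN v hv0
  have h2 : quadForm N v = r * z := by
    have h3 : quadForm N v = z * quadForm 1 v := by
      simp [quadForm, ← hv, dotProduct_smul]
    rw [h3, hry, quadForm, Matrix.one_mulVec, hy]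
    ring
  rw [h2, Complex.re_ofReal_mul] at h1
  exact Or.inl (pos_of_mul_pos_right h1 hr.le)

end QuadForm

/-! ### The geometric mean as an integral of parallel sums -/

section GeomMean

variable {n : ℕ} {X Y : Matrix (Fin n) (Fin n) ℂ}

/-- An eigenvector `v` of `T Y T` with eigenvalue `z` gives `w = T v` with `Y w = z X w`, hence `⟨Y
w, w⟩ = z ⟨X w, w⟩`. Both forms have positive real part, so `z` cannot be a nonpositive real. -/
theorem spectrum_subset_of_sandwich (hX : IsStrictlyAccretive X) (hY : IsStrictlyAccretive Y)
    {S T : Matrix (Fin n) (Fin n) ℂ} (hSS : S * S = X) (hST : S * T = 1) :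
    spectrum ℂ (T * Y * T) ⊆ Complex.slitPlane := by
  intro z hz
  rw [Matrix.mem_spectrum_iff_isRoot_charpoly, Polynomial.IsRoot.def, eval_charpoly_eq_det,
    ← Matrix.exists_mulVec_eq_zero_iff] at hz
  obtain ⟨v, hv0, hv⟩ := hz
  rw [Matrix.sub_mulVec, Matrix.smul_mulVec, Matrix.one_mulVec, sub_eq_zero] at hv
  have hSw : S.mulVec (T.mulVec v) = v := by rw [Matrix.mulVec_mulVec, hST, Matrix.one_mulVec]
  have hw0 : T.mulVec v ≠ 0 := fun h => hv0 (by rw [← hSw, h, Matrix.mulVec_zero])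
  have h1 : Y.mulVec (T.mulVec v) = z • X.mulVec (T.mulVec v) := by
    have h2 := congrArg S.mulVec hv
    rw [Matrix.mulVec_smul, Matrix.mulVec_mulVec, ← Matrix.mul_assoc, ← Matrix.mul_assoc, hST,
      Matrix.one_mul, ← Matrix.mulVec_mulVec] at h2
    rw [← h2, ← hSS, ← Matrix.mulVec_mulVec, hSw]
  have h3 : quadForm Y (T.mulVec v) = z * quadForm X (T.mulVec v) := by
    rw [quadForm, h1, dotProduct_smul, smul_eq_mul, quadForm]
  by_contra hz
  rw [Complex.mem_slitPlane_iff, not_or, not_lt, not_not] at hz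
  have h4 := hY _ hw0
  rw [h3, Complex.mul_re, hz.2, zero_mul, sub_zero] at h4
  linarith [mul_nonpos_of_nonpos_of_nonneg hz.1 (hX _ hw0).le]

theorem matrixPow_half_mul_half (hX : IsStrictlyAccretive X) :
    matrixPow X (1 / 2) * matrixPow X (1 / 2) = X := by
  rw [← matrixPow_add hX.spectrum_subset, add_halves, matrixPow_one hX.spectrum_subset]

theorem matrixPow_half_mul_neg_half (hX : IsStrictlyAccretive X) :
    matrixPow X (1 / 2) * matrixPow X (-(1 / 2)) = 1 := by
  rw [← matrixPow_add hX.spectrum_subset, add_neg_cancel, matrixPow_zero hX.spectrum_subset]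

theorem weightedGeomMean_zero (hX : IsStrictlyAccretive X) (hY : IsStrictlyAccretive Y) :
    weightedGeomMean 0 X Y = X := by
  rw [weightedGeomMean, matrixPow_zero (spectrum_subset_of_sandwich hX hY
    (matrixPow_half_mul_half hX) (matrixPow_half_mul_neg_half hX)), Matrix.mul_one,
    matrixPow_half_mul_half hX]

theorem weightedGeomMean_one (hX : IsStrictlyAccretive X) (hY : IsStrictlyAccretive Y) :
    weightedGeomMean 1 X Y = Y := by
  have h := matrixPow_half_mul_neg_half hX
  rw [weightedGeomMean, matrixPow_one (spectrum_subset_of_sandwich hX hY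
    (matrixPow_half_mul_half hX) h), ← Matrix.mul_assoc, ← Matrix.mul_assoc, h, Matrix.one_mul,
    Matrix.mul_assoc, mul_eq_one_comm.1 h, Matrix.mul_one]

/-- The weighted geometric mean is an average of the parallel sums `Z s = (X⁻¹ + s Y⁻¹)⁻¹`. -/
theorem exists_parallelSum (hX : IsStrictlyAccretive X) (hY : IsStrictlyAccretive Y) :
    ∃ Z : ℝ → Matrix (Fin n) (Fin n) ℂ,
      (∀ s > 0, ∀ x, ∃ u v, u + v = x ∧ X.mulVec u = (Z s).mulVec x ∧
        Y.mulVec v = (s : ℂ) • (Z s).mulVec x) ∧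
      ∀ t ∈ Set.Ioo (0 : ℝ) 1, ∀ x,
        MeasureTheory.IntegrableOn (fun s : ℝ => ((s ^ (t - 1) : ℝ) : ℂ) * quadForm (Z s) x)
          (Set.Ioi 0) ∧
        quadForm (weightedGeomMean t X Y) x = cpowConst t *
          ∫ s in Set.Ioi (0 : ℝ), ((s ^ (t - 1) : ℝ) : ℂ) * quadForm (Z s) x := by
  have hSS := matrixPow_half_mul_half hX
  have hST := matrixPow_half_mul_neg_half hX
  have hM := spectrum_subset_of_sandwich hX hY hSS hST
  set S := matrixPow X (1 / 2) with hS
  set T := matrixPow X (-(1 / 2)) with hT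
  set M := T * Y * T with hMdef
  -- With `M = T Y T` and `T = S⁻¹`, this is `(X⁻¹ + s Y⁻¹)⁻¹` written without inverting `X` or `Y`.
  refine ⟨fun s => S * (M * ((s : ℂ) • (1 : Matrix (Fin n) (Fin n) ℂ) + M)⁻¹) * S, ?_, ?_⟩
  · intro s hs x
    set W := ((s : ℂ) • (1 : Matrix (Fin n) (Fin n) ℂ) + M)⁻¹ with hW
    have h1 : (s : ℂ) • W + M * W = 1 := by
      have := Matrix.mul_nonsing_inv _ (isUnit_det_smul_one_add hM hs.le)
      rwa [Matrix.add_mul, Matrix.smul_mul, Matrix.one_mul] at this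
    -- The second vector is `v = s Y⁻¹ Z x`, since `Y T W S = S M W S = Z`; the first is `x - v =
    -- X⁻¹ Z x`.
    refine ⟨x - ((s : ℂ) • (T * W * S)).mulVec x, ((s : ℂ) • (T * W * S)).mulVec x,
      sub_add_cancel _ _, ?_, ?_⟩
    · have h2 : X - X * ((s : ℂ) • (T * W * S)) = S * (M * W) * S := by
        have h3 : X * (T * W * S) = S * W * S := by
          calc X * (T * W * S) = S * (S * T) * W * S := by rw [← hSS]; simp only [Matrix.mul_assoc]
            _ = S * W * S := by rw [hST, Matrix.mul_one]
        rw [Matrix.mul_smul, h3, eq_sub_iff_add_eq'.2 h1, Matrix.mul_sub, Matrix.sub_mul,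
          Matrix.mul_one, hSS, Matrix.mul_smul, Matrix.smul_mul]
      rw [Matrix.mulVec_sub, Matrix.mulVec_mulVec, ← Matrix.sub_mulVec, h2]
    · have h2 : Y * (T * W * S) = S * (M * W) * S := by
        calc Y * (T * W * S) = (S * T) * Y * T * W * S := by
              rw [hST, Matrix.one_mul]; simp only [Matrix.mul_assoc]
          _ = S * (M * W) * S := by rw [hMdef]; simp only [Matrix.mul_assoc]
      rw [Matrix.mulVec_mulVec, Matrix.mul_smul, h2, Matrix.smul_mulVec]
  · intro t ht x
    exact map_matrixPow_eq_integral hM ht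
      { toFun := fun N => quadForm (S * N * S) x
        map_add' := fun N N' => by rw [Matrix.mul_add, Matrix.add_mul, quadForm_add]
        map_smul' := fun k N => by
          simp [quadForm, Matrix.smul_mulVec, dotProduct_smul] }

end GeomMean

/-! ### Sectorial Cauchy–Schwarz and the bound on parallel sums -/

section Sectorial

variable {n : ℕ} {α : ℝ} {X Y Z : Matrix (Fin n) (Fin n) ℂ}

theorem isStrictlyAccretive_of_mem_sectorialMatrices (hX : X ∈ sectorialMatrices n α) :
    IsStrictlyAccretive X := by
  intro x hx
  obtain ⟨r, y, hr, hy, hry⟩ := exists_quadForm_eq_mul hx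
  rw [hry, Complex.re_ofReal_mul]
  exact mul_pos hr (hX y hy).1

theorem cos_mul_abs_im_quadForm_le (hα : 0 < Real.cos α) (hX : X ∈ sectorialMatrices n α)
    (x : Fin n → ℂ) : Real.cos α * |(quadForm X x).im| ≤ Real.sin α * (quadForm X x).re := by
  rcases eq_or_ne x 0 with rfl | hx
  · simp [quadForm]
  obtain ⟨r, y, hr, hy, hry⟩ := exists_quadForm_eq_mul hx
  have h := (hX y hy).2
  change |(quadForm X y).im| ≤ Real.tan α * (quadForm X y).re at h
  rw [hry, Complex.re_ofReal_mul, Complex.im_ofReal_mul, abs_mul, abs_of_pos hr]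
  have h2 := mul_le_mul_of_nonneg_left h (mul_pos hα hr).le
  have h3 : Real.cos α * Real.tan α = Real.sin α := by
    rw [mul_comm, Real.tan_mul_cos hα.ne']
  calc Real.cos α * (r * |(quadForm X y).im|) = Real.cos α * r * |(quadForm X y).im| := by ring
    _ ≤ _ := h2
    _ = (Real.cos α * Real.tan α) * (r * (quadForm X y).re) := by ring
    _ = _ := by rw [h3]

/-- A sharp Cauchy–Schwarz inequality for sectorial forms. -/
theorem cos_sq_mul_re_le (hα₀ : 0 ≤ α) (hα₁ : α < Real.pi / 2) (hX : X ∈ sectorialMatrices n α)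
    (u y : Fin n → ℂ) : 2 * Real.cos α ^ 2 * (star y ⬝ᵥ X.mulVec u).re ≤
      Real.cos α ^ 2 * (quadForm X u).re + (quadForm X y).re := by
  have hC : 0 < Real.cos α := Real.cos_pos_of_mem_Ioo ⟨by linarith [Real.pi_pos], hα₁⟩
  have hacc := isStrictlyAccretive_of_mem_sectorialMatrices hX
  have him := cos_mul_abs_im_quadForm_le hC hX
  -- For `α = 0` the form is Hermitian and the claim is positivity at `u - y`; the general argument
  -- divides by `sin α`.
  rcases hα₀.eq_or_lt with rfl | hα
  · have h0 : ∀ x, (quadForm X x).im = 0 := fun x => by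
      have := him x
      simp only [Real.cos_zero, Real.sin_zero, one_mul, zero_mul] at this
      exact abs_nonpos_iff.1 this
    have hsym := star_dotProduct_mulVec_of_quadForm_im_eq_zero h0 u y
    have hpos : 0 ≤ (quadForm X ((1 : ℂ) • u - y)).re := by
      rcases eq_or_ne ((1 : ℂ) • u - y) 0 with h | h
      · rw [h]; simp [quadForm]
      · exact (hacc _ h).le
    rw [quadForm_smul_sub, hsym] at hpos
    simp at hpos
    simp only [Real.cos_zero]
    linarith
  · have hS : 0 < Real.sin α := Real.sin_pos_of_pos_of_lt_pi hα (by linarith)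
    have hCS := Real.sin_sq_add_cos_sq α
    set S := Real.sin α
    set C := Real.cos α
    -- The scalars are `cos α · e^(∓iα)`. The sector inequality is used with opposite signs of the
    -- imaginary part. As the moduli agree, the imaginary parts of the forms at `u` and `y` cancel
    -- in the sum, and this choice of phase also cancels `Re b`, leaving only `Re a`.
    have h1 := him ((⟨C ^ 2, -(C * S)⟩ : ℂ) • u - y)
    have h2 := him ((⟨C ^ 2, C * S⟩ : ℂ) • u - y)
    have h1' := mul_le_mul_of_nonneg_left (le_abs_self _) hC.le |>.trans h1
    have h2' := mul_le_mul_of_nonneg_left (neg_le_abs _) hC.le |>.trans h2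
    rw [quadForm_smul_sub] at h1' h2'
    set a := star y ⬝ᵥ X.mulVec u
    set b := star u ⬝ᵥ X.mulVec y
    have hk₁ : star (⟨C ^ 2, -(C * S)⟩ : ℂ) * ⟨C ^ 2, -(C * S)⟩ = ((C ^ 2 : ℝ) : ℂ) := by
      apply Complex.ext
      · simp [-Complex.ofReal_pow]; linear_combination C ^ 2 * hCS
      · simp [-Complex.ofReal_pow]; ring
    have hk₂ : star (⟨C ^ 2, C * S⟩ : ℂ) * ⟨C ^ 2, C * S⟩ = ((C ^ 2 : ℝ) : ℂ) := by
      apply Complex.ext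
      · simp [-Complex.ofReal_pow]; linear_combination C ^ 2 * hCS
      · simp [-Complex.ofReal_pow]; ring
    rw [hk₁] at h1'
    rw [hk₂] at h2'
    simp only [Complex.sub_im, Complex.add_im, Complex.sub_re, Complex.add_re,
      Complex.mul_re, Complex.mul_im, Complex.ofReal_re, Complex.ofReal_im,
      Complex.star_def, Complex.conj_re, Complex.conj_im] at h1' h2'
    refine le_of_mul_le_mul_left ?_ hS
    linear_combination (h1' + h2') / 2

theorem re_star_dotProduct_le (hα₀ : 0 ≤ α) (hα₁ : α < Real.pi / 2)
    (hX : X ∈ sectorialMatrices n α) (u y : Fin n → ℂ) :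
    2 * (star y ⬝ᵥ X.mulVec u).re ≤
      (quadForm X u).re + (1 / Real.cos α) ^ 2 * (quadForm X y).re := by
  have hC : 0 < Real.cos α := Real.cos_pos_of_mem_Ioo ⟨by linarith [Real.pi_pos], hα₁⟩
  have h := cos_sq_mul_re_le hα₀ hα₁ hX u y
  refine le_of_mul_le_mul_left ?_ (pow_pos hC 2)
  have : Real.cos α ^ 2 * (1 / Real.cos α) ^ 2 = 1 := by field_simp
  linear_combination h - (quadForm X y).re * this

/-- Since `X u` and `s⁻¹ Y v` both equal `Z x`, the vector `x` on the other side may be split in any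
way. The splitting need not be the one into `u` and `v`. -/
theorem quadForm_eq_of_parallelSum {s : ℝ} (hs : 0 < s) {x u v y z : Fin n → ℂ}
    (hu : X.mulVec u = Z.mulVec x) (hv : Y.mulVec v = (s : ℂ) • Z.mulVec x) (hyz : y + z = x) :
    quadForm Z x = star y ⬝ᵥ X.mulVec u + ((s⁻¹ : ℝ) : ℂ) * (star z ⬝ᵥ Y.mulVec v) := by
  have hs' : (s : ℂ) ≠ 0 := by exact_mod_cast hs.ne'
  rw [hu, hv, quadForm, dotProduct_smul, smul_eq_mul, Complex.ofReal_inv,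
    inv_mul_cancel_left₀ hs', ← add_dotProduct, ← star_add, hyz]

/-- This replaces the variational description of the parallel sum as a minimum over splittings, at
the cost of `sec²α`. With the trial splitting `(y, z)`, Cauchy–Schwarz leaves `½ Re⟨Z x, x⟩` on the
right, which is absorbed using the splitting `(u, v)`. -/
theorem re_quadForm_parallelSum_le (hα₀ : 0 ≤ α) (hα₁ : α < Real.pi / 2)
    (hX : X ∈ sectorialMatrices n α) (hY : Y ∈ sectorialMatrices n α) {s : ℝ} (hs : 0 < s)
    {x u v y z : Fin n → ℂ} (huv : u + v = x)
    (hu : X.mulVec u = Z.mulVec x) (hv : Y.mulVec v = (s : ℂ) • Z.mulVec x) (hyz : y + z = x) :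
    (quadForm Z x).re ≤
      (1 / Real.cos α) ^ 2 * ((quadForm X y).re + s⁻¹ * (quadForm Y z).re) := by
  have h1 := congrArg Complex.re (quadForm_eq_of_parallelSum hs hu hv hyz)
  have h2 := congrArg Complex.re (quadForm_eq_of_parallelSum hs hu hv huv)
  rw [Complex.add_re, Complex.re_ofReal_mul] at h1 h2
  change _ = (quadForm X u).re + s⁻¹ * (quadForm Y v).re at h2
  have h3 := re_star_dotProduct_le hα₀ hα₁ hX u y
  have h4 := mul_le_mul_of_nonneg_left (re_star_dotProduct_le hα₀ hα₁ hY v z) (inv_pos.2 hs).le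
  linarith

theorem quadForm_parallelSum_im_eq_zero {s : ℝ} (hs : 0 < s) (hX : ∀ x, (quadForm X x).im = 0)
    (hY : ∀ x, (quadForm Y x).im = 0) {x u v : Fin n → ℂ} (huv : u + v = x)
    (hu : X.mulVec u = Z.mulVec x) (hv : Y.mulVec v = (s : ℂ) • Z.mulVec x) :
    (quadForm Z x).im = 0 := by
  have h2 := congrArg Complex.im (quadForm_eq_of_parallelSum hs hu hv huv)
  rw [Complex.add_im, Complex.im_ofReal_mul] at h2
  change _ = (quadForm X u).im + s⁻¹ * (quadForm Y v).im at h2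
  rw [h2, hX, hY, mul_zero, add_zero]

theorem isStrictlyAccretive_realPart_add {A B : Matrix (Fin n) (Fin n) ℂ}
    (hA : IsStrictlyAccretive A) (hB : IsStrictlyAccretive B) {l : ℝ} (hl₀ : 0 ≤ l) (hl₁ : l ≤ 1) :
    IsStrictlyAccretive (ℜ (l • A + (1 - l) • B) : Matrix (Fin n) (Fin n) ℂ) := by
  intro x hx
  rw [quadForm_realPart, Complex.ofReal_re, quadForm_add, quadForm_real_smul, quadForm_real_smul,
    Complex.add_re, Complex.re_ofReal_mul, Complex.re_ofReal_mul]
  have h1 := hA x hx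
  have h2 := hB x hx
  rcases hl₀.eq_or_lt with rfl | hl
  · simpa using h2
  · have := mul_pos hl h1
    have := mul_nonneg (sub_nonneg.2 hl₁) h2.le
    linarith

theorem re_integral_mul_quadForm {Z : ℝ → Matrix (Fin n) (Fin n) ℂ} {t : ℝ} {x : Fin n → ℂ}
    (h : MeasureTheory.IntegrableOn (fun s : ℝ => ((s ^ (t - 1) : ℝ) : ℂ) * quadForm (Z s) x)
      (Set.Ioi 0)) :
    MeasureTheory.IntegrableOn (fun s : ℝ => s ^ (t - 1) * (quadForm (Z s) x).re) (Set.Ioi 0) ∧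
      (∫ s in Set.Ioi (0 : ℝ), ((s ^ (t - 1) : ℝ) : ℂ) * quadForm (Z s) x).re =
        ∫ s in Set.Ioi (0 : ℝ), s ^ (t - 1) * (quadForm (Z s) x).re := by
  have h1 := h.re
  have h2 := integral_re h
  simp only [RCLike.re_eq_complex_re, Complex.re_ofReal_mul] at h1 h2
  exact ⟨h1, h2.symm⟩

end Sectorial

/-! ### The inequality for means -/

theorem mainTheorem7 (n : ℕ) (α : ℝ) (hα₀ : 0 ≤ α) (hα₁ : α < Real.pi / 2)
    (A B C D : Matrix (Fin n) (Fin n) ℂ)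
    (hA : A ∈ sectorialMatrices n α) (hB : B ∈ sectorialMatrices n α)
    (hC : C ∈ sectorialMatrices n α) (hD : D ∈ sectorialMatrices n α)
    (t l : ℝ) (ht₀ : 0 ≤ t) (ht₁ : t ≤ 1) (hl₀ : 0 ≤ l) (hl₁ : l ≤ 1) :
    (ℜ (l • weightedGeomMean t A C + (1 - l) • weightedGeomMean t B D) :
        Matrix (Fin n) (Fin n) ℂ) ≤
      ((1 / Real.cos α) ^ 2) •
        weightedGeomMean t
          (ℜ (l • A + (1 - l) • B) : Matrix (Fin n) (Fin n) ℂ)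
          (ℜ (l • C + (1 - l) • D) : Matrix (Fin n) (Fin n) ℂ) := by
  have hA' := isStrictlyAccretive_of_mem_sectorialMatrices hA
  have hB' := isStrictlyAccretive_of_mem_sectorialMatrices hB
  have hC' := isStrictlyAccretive_of_mem_sectorialMatrices hC
  have hD' := isStrictlyAccretive_of_mem_sectorialMatrices hD
  have hP := isStrictlyAccretive_realPart_add hA' hB' hl₀ hl₁
  have hQ := isStrictlyAccretive_realPart_add hC' hD' hl₀ hl₁
  have hPr := quadForm_realPart (l • A + (1 - l) • B)
  have hQr := quadForm_realPart (l • C + (1 - l) • D)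
  set P : Matrix (Fin n) (Fin n) ℂ := (ℜ (l • A + (1 - l) • B) : Matrix (Fin n) (Fin n) ℂ)
  set Q : Matrix (Fin n) (Fin n) ℂ := (ℜ (l • C + (1 - l) • D) : Matrix (Fin n) (Fin n) ℂ)
  have hcos : 0 < Real.cos α := Real.cos_pos_of_mem_Ioo ⟨by linarith [Real.pi_pos], hα₁⟩
  have hsec : 1 ≤ (1 / Real.cos α) ^ 2 :=
    one_le_pow₀ ((one_le_div hcos).2 (Real.cos_le_one α))
  -- At the endpoints the mean is one of the two matrices.
  have hend : ∀ E F : Matrix (Fin n) (Fin n) ℂ, IsStrictlyAccretive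
      (ℜ (l • E + (1 - l) • F) : Matrix (Fin n) (Fin n) ℂ) →
      (ℜ (l • E + (1 - l) • F) : Matrix (Fin n) (Fin n) ℂ) ≤
        ((1 / Real.cos α) ^ 2) • (ℜ (l • E + (1 - l) • F) : Matrix (Fin n) (Fin n) ℂ) := by
    intro E F hEF
    have him : ∀ x, (quadForm (ℜ (l • E + (1 - l) • F) : Matrix (Fin n) (Fin n) ℂ) x).im = 0 :=
      fun x => by rw [quadForm_realPart, Complex.ofReal_im]
    refine le_of_quadForm him (fun x => ?_) fun x => ?_
    · rw [quadForm_real_smul, Complex.im_ofReal_mul, him, mul_zero]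
    · rw [quadForm_real_smul, Complex.re_ofReal_mul]
      rcases eq_or_ne x 0 with rfl | hx
      · simp [quadForm]
      · exact le_mul_of_one_le_left (hEF x hx).le hsec
  rcases ht₀.eq_or_lt with rfl | ht0
  · rw [weightedGeomMean_zero hA' hC', weightedGeomMean_zero hB' hD',
      weightedGeomMean_zero hP hQ]
    exact hend A B hP
  rcases ht₁.eq_or_lt with rfl | ht1
  · rw [weightedGeomMean_one hA' hC', weightedGeomMean_one hB' hD',
      weightedGeomMean_one hP hQ]
    exact hend C D hQ
  have ht : t ∈ Set.Ioo (0 : ℝ) 1 := ⟨ht0, ht1⟩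
  obtain ⟨Z₁, hZ₁, hi₁⟩ := exists_parallelSum hA' hC'
  obtain ⟨Z₂, hZ₂, hi₂⟩ := exists_parallelSum hB' hD'
  obtain ⟨Z₀, hZ₀, hi₀⟩ := exists_parallelSum hP hQ
  have hPim : ∀ x, (quadForm P x).im = 0 := fun x => by rw [hPr, Complex.ofReal_im]
  have hQim : ∀ x, (quadForm Q x).im = 0 := fun x => by rw [hQr, Complex.ofReal_im]
  refine le_of_quadForm (fun x => by rw [quadForm_realPart, Complex.ofReal_im]) (fun x => ?_)
    fun x => ?_
  -- The mean of the real parts is Hermitian, because their parallel sums have real quadratic forms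
  -- for every `s`.
  · rw [quadForm_real_smul, Complex.im_ofReal_mul, (hi₀ t ht x).2, Complex.im_ofReal_mul]
    have h1 := integral_im (hi₀ t ht x).1
    simp only [RCLike.im_eq_complex_im, Complex.im_ofReal_mul] at h1
    rw [← h1, MeasureTheory.setIntegral_eq_zero_of_forall_eq_zero, mul_zero, mul_zero]
    intro s hs
    obtain ⟨u, v, huv, hu, hv⟩ := hZ₀ s hs x
    rw [quadForm_parallelSum_im_eq_zero hs hPim hQim huv hu hv, mul_zero]
  · obtain ⟨hI₁, hE₁⟩ := re_integral_mul_quadForm (hi₁ t ht x).1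
    obtain ⟨hI₂, hE₂⟩ := re_integral_mul_quadForm (hi₂ t ht x).1
    obtain ⟨hI₀, hE₀⟩ := re_integral_mul_quadForm (hi₀ t ht x).1
    rw [quadForm_realPart, Complex.ofReal_re, quadForm_add, quadForm_real_smul,
      quadForm_real_smul, quadForm_real_smul, Complex.add_re, Complex.re_ofReal_mul,
      Complex.re_ofReal_mul, Complex.re_ofReal_mul, (hi₁ t ht x).2, (hi₂ t ht x).2,
      (hi₀ t ht x).2, Complex.re_ofReal_mul, Complex.re_ofReal_mul, Complex.re_ofReal_mul,
      hE₁, hE₂, hE₀]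
    have hmono : l * (∫ s in Set.Ioi (0 : ℝ), s ^ (t - 1) * (quadForm (Z₁ s) x).re) +
        (1 - l) * (∫ s in Set.Ioi (0 : ℝ), s ^ (t - 1) * (quadForm (Z₂ s) x).re) ≤
        (1 / Real.cos α) ^ 2 *
          ∫ s in Set.Ioi (0 : ℝ), s ^ (t - 1) * (quadForm (Z₀ s) x).re := by
      rw [← MeasureTheory.integral_const_mul, ← MeasureTheory.integral_const_mul,
        ← MeasureTheory.integral_const_mul,
        ← MeasureTheory.integral_add (hI₁.const_mul l) (hI₂.const_mul (1 - l))]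
      refine MeasureTheory.setIntegral_mono_on ((hI₁.const_mul l).add (hI₂.const_mul (1 - l)))
        (hI₀.const_mul _) measurableSet_Ioi fun s hs => ?_
      -- The splitting belonging to `P` and `Q` is the trial splitting for both pairs `(A, C)` and
      -- `(B, D)`. For `Z₀` it gives an equality, so the convex combination of the two bounds is
      -- exactly `sec²α ⟨Z₀ x, x⟩`.
      obtain ⟨y, z, hyz, hy, hz⟩ := hZ₀ s hs x
      obtain ⟨u₁, v₁, huv₁, hu₁, hv₁⟩ := hZ₁ s hs x
      obtain ⟨u₂, v₂, huv₂, hu₂, hv₂⟩ := hZ₂ s hs x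
      have h₁ := re_quadForm_parallelSum_le hα₀ hα₁ hA hC hs huv₁ hu₁ hv₁ hyz
      have h₂ := re_quadForm_parallelSum_le hα₀ hα₁ hB hD hs huv₂ hu₂ hv₂ hyz
      have h₀ := congrArg Complex.re (quadForm_eq_of_parallelSum hs hy hz hyz)
      rw [Complex.add_re, Complex.re_ofReal_mul] at h₀
      change _ = (quadForm P y).re + s⁻¹ * (quadForm Q z).re at h₀
      rw [hPr, hQr, Complex.ofReal_re, Complex.ofReal_re, quadForm_add, quadForm_add,
        quadForm_real_smul, quadForm_real_smul, quadForm_real_smul, quadForm_real_smul,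
        Complex.add_re, Complex.add_re, Complex.re_ofReal_mul, Complex.re_ofReal_mul,
        Complex.re_ofReal_mul, Complex.re_ofReal_mul] at h₀
      have hw : 0 ≤ s ^ (t - 1) := Real.rpow_nonneg (le_of_lt hs) _
      have h₃ := mul_le_mul_of_nonneg_left h₁ hl₀
      have h₄ := mul_le_mul_of_nonneg_left h₂ (sub_nonneg.2 hl₁)
      have h₅ := mul_le_mul_of_nonneg_left (add_le_add h₃ h₄) hw
      rw [h₀]
      linear_combination h₅
    have := mul_le_mul_of_nonneg_left hmono (cpowConst_pos ht).le
    linear_combination this
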